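/- Let $(M^n,g)$ be an oriented Riemannian manifold with Levi-Civita connection $\nabla$, let $\tilde P\to M$ be a spin structure on $M$ and let $\Sigma M=\tilde P\times_{\rho}\Sigma_n$ be its complex spin bundle, of rank $2^{\lfloor n/2\rfloor}$, with Clifford multiplication satisfying $X\cdot Y\cdot+Y\cdot X\cdot=-2\langle X,Y\rangle$ and with the spin connection induced by $\nabla$. Let $E\to M$ be a smooth complex vector bundle with a smooth (complex linear) connection $\nabla^E$ of curvature $R^E_{X,Y}=\nabla^E_X\nabla^E_Y-\nabla^E_Y\nabla^E_X-\nabla^E_{[X,Y]}$, and let $f:M\to\mathbb R$ be a smooth function. Denote by $\nabla$ also the tensor product connection on $\Sigma_E=\Sigma M\otimes E$, and let $D_E=\sum_i e_i\cdot\nabla_{e_i}$ be the twisted Dirac operator on sections of $\Sigma_E$, where $(e_i)$ is any local oriented orthonormal frame of $TM$. Then the weighted twisted Dirac operator $D_{E,f}=e^{f/2}D_E\,e^{-f/2}$ satisfies, on smooth sections of $\Sigma_E$, $$D_{E,f}^2=-\Delta_f+\tfrac14\mathrm R_f+\mathfrak R^E .$$ Here $\Delta_f=\Delta-\nabla_{\nabla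 f}$ is the weighted connection Laplacian on $\Sigma_E$, with $\Delta=\sum_i(\nabla_{e_i}\nabla_{e_i}-\nabla_{\nabla_{e_i}e_i})$; $\mathrm R_f=\mathrm R+2\Delta f-|\nabla f|^2$ is the weighted scalar curvature, with $\mathrm R$ the scalar curvature of $g$ and $\Delta f=\operatorname{div}\nabla f$; and $\mathfrak R^E$ is the endomorphism of $\Sigma_E$ defined locally by $$\mathfrak R^E(\psi\otimes u)=\tfrac12\sum_{i,j}e_i\cdot e_j\cdot\psi\otimes R^E_{e_i,e_j}u .$$ -/

import Mathlib

open Bundle Manifold Module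
open scoped ContDiff TensorProduct Topology

namespace WeightedSpin

noncomputable section

set_option linter.unusedSectionVars false

section CliffordAlgebra

/-- The quadratic form `v ↦ -|v|²` on `ℝⁿ`, so that `v * w + w * v = -2⟨v, w⟩` in its Clifford
algebra. -/
def cliffordForm (n : ℕ) : QuadraticForm ℝ (Fin n → ℝ) :=
  QuadraticMap.weightedSumSquares ℝ (fun _ : Fin n => (-1 : ℝ))

/-- The real Clifford algebra `Cl_n`. -/
abbrev Cl (n : ℕ) : Type := CliffordAlgebra (cliffordForm n)

/-- The inclusion `ℝⁿ ⊂ Cl_n`. -/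
def vec {n : ℕ} : (Fin n → ℝ) →ₗ[ℝ] Cl n := CliffordAlgebra.ι (cliffordForm n)

/-- The group `Spin(n) ⊂ Cl_n`. -/
abbrev Spin (n : ℕ) : Type := spinGroup (cliffordForm n)

/-- `Spin(n)` carries the subspace topology of the finite-dimensional vector space `Cl_n`. -/
instance spinTopology (n : ℕ) : TopologicalSpace (Spin n) :=
  (moduleTopology ℝ (Cl n)).induced Subtype.val

/-- The complex vector space `Σ_n` of dimension `2 ^ ⌊n / 2⌋`. -/
abbrev Spinor (n : ℕ) : Type := Fin (2 ^ (n / 2)) → ℂ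

/-- A complex representation of `Cl_n` on `Σ_n`. By the dimension of `Σ_n`, it is irreducible, and
its restriction to `Spin(n)` is the spin representation. -/
abbrev SpinorRep (n : ℕ) : Type := Cl n →ₐ[ℝ] Module.End ℂ (Spinor n)

end CliffordAlgebra

section SpinStructure

variable {n : ℕ} {M : Type*} [TopologicalSpace M]
  [ChartedSpace (EuclideanSpace ℝ (Fin n)) M] [IsManifold (𝓡 n) ∞ M]

/-- Smoothness of a vector field on a set. -/
def SmoothFieldOn (X : Π x : M, TangentSpace (𝓡 n) x) (U : Set M) : Prop :=
  ContMDiffOn (𝓡 n) ((𝓡 n).prod 𝓘(ℝ, EuclideanSpace ℝ (Fin n))) ∞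
    (fun x => TotalSpace.mk' (EuclideanSpace ℝ (Fin n)) x (X x)) U

variable (n M) in
/-- An orientation of `M`: orientations of the tangent spaces which are, near every point,
induced by a smooth frame. -/
structure ManifoldOrientation where
  /-- The orientation of the tangent space at a point. -/
  toFun (x : M) : Orientation ℝ (TangentSpace (𝓡 n) x) (Fin n)
  exists_frame (x₀ : M) : ∃ U : Set M, IsOpen U ∧ x₀ ∈ U ∧
    ∃ e : Fin n → Π x : M, TangentSpace (𝓡 n) x,
      (∀ i, SmoothFieldOn (e i) U) ∧
      ∀ x ∈ U, ∃ b : Basis (Fin n) ℝ (TangentSpace (𝓡 n) x),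
        (∀ i, b i = e i x) ∧ b.orientation = toFun x

variable [RiemannianBundle (fun x : M => TangentSpace (𝓡 n) x)]

/-- The total space of the bundle of oriented orthonormal frames. -/
structure OrientedFrame (o : ManifoldOrientation n M) where
  /-- The base point. -/
  base : M
  /-- The frame. -/
  basis : OrthonormalBasis (Fin n) ℝ (TangentSpace (𝓡 n) base)
  oriented : basis.toBasis.orientation = o.toFun base

/-- The topology of the frame bundle, as a subspace of `M × TM × ⋯ × TM`. -/
instance (o : ManifoldOrientation n M) : TopologicalSpace (OrientedFrame o) :=
  TopologicalSpace.induced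
    (fun p : OrientedFrame o =>
      (p.base, fun i => (⟨p.base, p.basis i⟩ : TangentBundle (𝓡 n) M))) inferInstance

universe u in
/-- A spin structure on an oriented Riemannian manifold: a principal `Spin(n)`-bundle which is a
two-fold covering of the bundle of oriented orthonormal frames, equivariantly for the homomorphism
`Spin(n) → SO(n)`, `g ↦ (v ↦ g v g⁻¹)`. -/
structure SpinStructure (o : ManifoldOrientation n M) where
  /-- The fibres of the principal bundle. -/
  P : M → Type u
  /-- The topology of the total space. -/
  topology : TopologicalSpace (TotalSpace (Spin n) P)
  /-- The right action of `Spin(n)`. -/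
  act {x : M} : P x → Spin n → P x
  act_one {x : M} (p : P x) : act p 1 = p
  act_mul {x : M} (p : P x) (g h : Spin n) : act p (g * h) = act (act p g) h
  act_simply_transitive {x : M} (p q : P x) : ∃! g : Spin n, act p g = q
  continuous_act : Continuous (fun a : TotalSpace (Spin n) P × Spin n =>
    (⟨a.1.1, act a.1.2 a.2⟩ : TotalSpace (Spin n) P))
  /-- The frame below a point of the principal bundle. -/
  frame {x : M} : P x → OrthonormalBasis (Fin n) ℝ (TangentSpace (𝓡 n) x)
  frame_oriented {x : M} (p : P x) : (frame p).toBasis.orientation = o.toFun x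
  isCoveringMap : IsCoveringMap (fun p : TotalSpace (Spin n) P =>
    (⟨p.1, frame p.2, frame_oriented p.2⟩ : OrientedFrame o))
  two_fold {x : M} (b : OrthonormalBasis (Fin n) ℝ (TangentSpace (𝓡 n) x))
    (hb : b.toBasis.orientation = o.toFun x) : Nat.card {p : P x // frame p = b} = 2
  frame_act {x : M} (p : P x) (g : Spin n) (v w : Fin n → ℝ)
    (h : vec w = (g : Cl n) * vec v * ((g⁻¹ : Spin n) : Cl n)) :
    ∑ i, v i • frame (act p g) i = ∑ i, w i • frame p i
  exists_local_section (x₀ : M) : ∃ U : Set M, IsOpen U ∧ x₀ ∈ U ∧ ∃ s : Π x : M, P x,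
    ContinuousOn (fun x => (⟨x, s x⟩ : TotalSpace (Spin n) P)) U ∧
    ∀ i, SmoothFieldOn (fun x => (frame (s x) i : TangentSpace (𝓡 n) x)) U

variable {o : ManifoldOrientation n M}

/-- The fibre at `x` of the spin bundle `ΣM = P ×_ρ Σ_n`. An element `[p, ψ]` of the associated
bundle is regarded as the equivariant map `P x → Σ_n` taking the value `ψ` at `p`. -/
def SpinorFiber (σ : SpinStructure o) (ρ : SpinorRep n) (x : M) :
    Submodule ℂ (σ.P x → Spinor n) where
  carrier := {φ | ∀ (p : σ.P x) (g : Spin n), φ (σ.act p g) = ρ ((g⁻¹ : Spin n) : Cl n) (φ p)}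
  add_mem' := by
    intro φ φ' h h' p g
    simp [h p g, h' p g]
  zero_mem' := by
    intro p g
    simp
  smul_mem' := by
    intro c φ h p g
    simp [h p g]

/-- A (local) spin gauge: a smooth local section of the principal `Spin(n)`-bundle over an open set.
It is smooth if it is continuous and the frame below it is smooth. Values of `lift` outside
`domain` are irrelevant. -/
structure SpinGauge (σ : SpinStructure o) where
  /-- The open set on which the gauge is defined. -/
  domain : Set M
  isOpen_domain : IsOpen domain
  /-- The local section of the principal bundle. -/
  lift (x : M) : σ.P x
  continuousOn_lift : letI := σ.topology
    ContinuousOn (fun x => (⟨x, lift x⟩ : TotalSpace (Spin n) σ.P)) domain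
  contMDiffOn_frame (i : Fin n) :
    SmoothFieldOn (fun x => (σ.frame (lift x) i : TangentSpace (𝓡 n) x)) domain

/-- The `i`-th vector field of the local orthonormal frame below a spin gauge. -/
def SpinGauge.frame {σ : SpinStructure o} (G : SpinGauge σ) (i : Fin n) (x : M) :
    TangentSpace (𝓡 n) x :=
  σ.frame (G.lift x) i

end SpinStructure

section Curvature

variable {n : ℕ} {M : Type*} [TopologicalSpace M]
  [ChartedSpace (EuclideanSpace ℝ (Fin n)) M] [IsManifold (𝓡 n) ∞ M]
  {F : Type*} [NormedAddCommGroup F] [NormedSpace ℝ F]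
  {V : M → Type*} [TopologicalSpace (TotalSpace F V)]
  [∀ x, AddCommGroup (V x)] [∀ x, Module ℝ (V x)] [∀ x, TopologicalSpace (V x)]
  [∀ x, IsTopologicalAddGroup (V x)] [∀ x, ContinuousSMul ℝ (V x)]
  [FiberBundle F V]

/-- The curvature `∇_X ∇_Y s - ∇_Y ∇_X s - ∇_[X, Y] s` of a connection, on vector fields and
sections. -/
def curvatureField (D : CovariantDerivative (𝓡 n) F V) (X Y : Π x : M, TangentSpace (𝓡 n) x)
    (s : Π x, V x) (x : M) : V x :=
  D (fun y => D s y (Y y)) x (X x) - D (fun y => D s y (X y)) x (Y x)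
    - D s x (VectorField.mlieBracket (𝓡 n) X Y x)

/-- The value `R_{v,w} u` of the curvature tensor, computed by local extension of the arguments. -/
def curvature (D : CovariantDerivative (𝓡 n) F V) {x : M} (v w : TangentSpace (𝓡 n) x) (u : V x) :
    V x :=
  curvatureField D (FiberBundle.extend (EuclideanSpace ℝ (Fin n)) v)
    (FiberBundle.extend (EuclideanSpace ℝ (Fin n)) w) (FiberBundle.extend F u) x

variable (n F) in
/-- A section is smooth near a point. -/
def SmoothNear (s : Π x, V x) (x : M) : Prop :=
  ∃ U ∈ 𝓝 x, ContMDiffOn (𝓡 n) ((𝓡 n).prod 𝓘(ℝ, F)) ∞ (fun y => TotalSpace.mk' F y (s y)) U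

variable (n F) in
/-- A section is differentiable at a point. -/
def DiffAt (s : Π x, V x) (x : M) : Prop :=
  MDifferentiableAt (𝓡 n) ((𝓡 n).prod 𝓘(ℝ, F)) (fun y => TotalSpace.mk' F y (s y)) x

theorem SmoothNear.eventually_diffAt [VectorBundle ℝ F V] {s : Π x, V x} {x : M}
    (hs : SmoothNear n F s x) : ∀ᶠ y in 𝓝 x, DiffAt n F s y := by
  obtain ⟨U, hU, h⟩ := hs
  filter_upwards [eventually_eventually_nhds.2 hU] with y hy
  exact (h.contMDiffAt hy).mdifferentiableAt (by simp)

theorem smoothNear_extend [VectorBundle ℝ F V] [ContMDiffVectorBundle ∞ F V (𝓡 n)] {x : M}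
    (u : V x) : SmoothNear n F (FiberBundle.extend F u) x :=
  FiberBundle.exists_contMDiffOn_extend (k := ∞) (𝓡 n) F u

theorem SmoothNear.add [VectorBundle ℝ F V] {s t : Π x, V x} {x : M} (hs : SmoothNear n F s x)
    (ht : SmoothNear n F t x) : SmoothNear n F (s + t) x := by
  obtain ⟨U, hU, hs⟩ := hs
  obtain ⟨W, hW, ht⟩ := ht
  exact ⟨U ∩ W, Filter.inter_mem hU hW,
    (hs.mono Set.inter_subset_left).add_section (ht.mono Set.inter_subset_right)⟩

variable [T2Space M] [VectorBundle ℝ F V] [ContMDiffVectorBundle ∞ F V (𝓡 n)]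

theorem SmoothNear.diffAt_covariantDerivative {D : CovariantDerivative (𝓡 n) F V}
    (hD : D.ContMDiffCovariantDerivative ∞) {x : M} {s : Π x, V x} (hs : SmoothNear n F s x)
    {Y : Π y : M, TangentSpace (𝓡 n) y} (hY : DiffAt n (EuclideanSpace ℝ (Fin n)) Y x) :
    DiffAt n F (fun y => D s y (Y y)) x := by
  have hdiff := hs.eventually_diffAt
  obtain ⟨W, hs, h⟩ := hs
  obtain ⟨U, hUs, hU, hxU⟩ := mem_nhds_iff.1 hs
  obtain ⟨χ, -, hχ⟩ := (SmoothBumpFunction.nhds_basis_tsupport (I := 𝓡 n) x).mem_iff.1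
    (hU.mem_nhds hxU)
  have hsm : ContMDiff (𝓡 n) ((𝓡 n).prod 𝓘(ℝ, F)) ∞
      (fun y => TotalSpace.mk' F y (((χ : M → ℝ) • s) y)) :=
    ContMDiffOn.smul_section_of_tsupport χ.contMDiff.contMDiffOn hU hχ (h.mono hUs)
  have h1 := (hD.contMDiff.contMDiff (σ := (χ : M → ℝ) • s)
    (by simpa using hsm.contMDiffOn)).contMDiffAt Filter.univ_mem (x := x)
  have h2 := (h1.mdifferentiableAt (by simp)).clm_bundle_apply hY
  refine h2.congr_of_eventuallyEq ?_
  filter_upwards [eventually_eventually_nhds.2 χ.eventuallyEq_one, hdiff] with y hy hy'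
  congr 1
  have h3 : D s y = D ((χ : M → ℝ) • s) y := by
    refine D.isCovariantDerivativeOnUniv.congr_of_eventuallyEq hy'
      (hsm.contMDiffAt.mdifferentiableAt (by simp)) Filter.univ_mem ?_
    filter_upwards [hy] with z hz
    simp [hz]
  rw [h3]

theorem curvatureField_congr {D : CovariantDerivative (𝓡 n) F V}
    (hD : D.ContMDiffCovariantDerivative ∞) {x : M} {s t : Π x, V x} (hs : SmoothNear n F s x)
    (ht : SmoothNear n F t x) (hst : ∀ᶠ y in 𝓝 x, s y = t y) {X Y : Π y : M, TangentSpace (𝓡 n) y}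
    (hX : DiffAt n (EuclideanSpace ℝ (Fin n)) X x) (hY : DiffAt n (EuclideanSpace ℝ (Fin n)) Y x) :
    curvatureField D X Y s x = curvatureField D X Y t x := by
  have key : ∀ᶠ y in 𝓝 x, D s y = D t y := by
    filter_upwards [hs.eventually_diffAt, ht.eventually_diffAt,
      eventually_eventually_nhds.2 hst] with y h1 h2 h3
    exact D.isCovariantDerivativeOnUniv.congr_of_eventuallyEq h1 h2 Filter.univ_mem h3
  have key' (Z : Π y : M, TangentSpace (𝓡 n) y) (hZ : DiffAt n (EuclideanSpace ℝ (Fin n)) Z x) :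
      D (fun y => D s y (Z y)) x = D (fun y => D t y (Z y)) x := by
    refine D.isCovariantDerivativeOnUniv.congr_of_eventuallyEq (hs.diffAt_covariantDerivative hD hZ)
      (ht.diffAt_covariantDerivative hD hZ) Filter.univ_mem ?_
    filter_upwards [key] with y hy
    rw [hy]
  rw [curvatureField, curvatureField, key' X hX, key' Y hY, key.self_of_nhds]

theorem curvatureField_add {D : CovariantDerivative (𝓡 n) F V}
    (hD : D.ContMDiffCovariantDerivative ∞) {x : M} {s t : Π x, V x} (hs : SmoothNear n F s x)
    (ht : SmoothNear n F t x) {X Y : Π y : M, TangentSpace (𝓡 n) y}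
    (hX : DiffAt n (EuclideanSpace ℝ (Fin n)) X x) (hY : DiffAt n (EuclideanSpace ℝ (Fin n)) Y x) :
    curvatureField D X Y (s + t) x = curvatureField D X Y s x + curvatureField D X Y t x := by
  have hst : SmoothNear n F (s + t) x := hs.add ht
  have key : ∀ᶠ y in 𝓝 x, D (s + t) y = D s y + D t y := by
    filter_upwards [hs.eventually_diffAt, ht.eventually_diffAt] with y h1 h2
    exact D.isCovariantDerivativeOnUniv.add h1 h2
  have key' (Z : Π y : M, TangentSpace (𝓡 n) y) (hZ : DiffAt n (EuclideanSpace ℝ (Fin n)) Z x) :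
      D (fun y => D (s + t) y (Z y)) x =
        D (fun y => D s y (Z y)) x + D (fun y => D t y (Z y)) x := by
    rw [← D.isCovariantDerivativeOnUniv.add (hs.diffAt_covariantDerivative hD hZ)
      (ht.diffAt_covariantDerivative hD hZ)]
    refine D.isCovariantDerivativeOnUniv.congr_of_eventuallyEq
      (hst.diffAt_covariantDerivative hD hZ)
      (mdifferentiableAt_add_section (hs.diffAt_covariantDerivative hD hZ)
      (ht.diffAt_covariantDerivative hD hZ)) Filter.univ_mem ?_
    filter_upwards [key] with y hy
    rw [hy]
    rfl
  rw [curvatureField, curvatureField, curvatureField, key' X hX, key' Y hY, key.self_of_nhds]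
  simp only [add_apply]
  abel

end Curvature

section ComplexConnection

variable {n : ℕ} {M : Type*} [TopologicalSpace M]
  [ChartedSpace (EuclideanSpace ℝ (Fin n)) M] [IsManifold (𝓡 n) ∞ M]
  {F : Type*} [NormedAddCommGroup F] [NormedSpace ℂ F]
  {E : M → Type*} [TopologicalSpace (TotalSpace F E)]
  [∀ x, AddCommGroup (E x)] [∀ x, Module ℂ (E x)] [∀ x, TopologicalSpace (E x)]
  [∀ x, IsTopologicalAddGroup (E x)] [∀ x, ContinuousSMul ℝ (E x)]
  [FiberBundle F E] [VectorBundle ℂ F E] [VectorBundle ℝ F E]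
  [ContMDiffVectorBundle ∞ F E (𝓡 n)]

/-- A smooth connection on a complex vector bundle, as opposed to the underlying real bundle. -/
structure IsComplexConnection (DE : CovariantDerivative (𝓡 n) F E) : Prop where
  smooth : DE.ContMDiffCovariantDerivative ∞
  complex_linear (c : ℂ) {s : Π x, E x} {x : M} (hs : DiffAt n F s x)
    (v : TangentSpace (𝓡 n) x) : DE (fun y => c • s y) x v = c • DE s x v

theorem eventually_extend_add {x : M} (u u' : E x) : ∀ᶠ y in 𝓝 x,
    FiberBundle.extend F (u + u') y = FiberBundle.extend F u y + FiberBundle.extend F u' y := by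
  have hx : x ∈ (trivializationAt F E x).baseSet := FiberBundle.mem_baseSet_trivializationAt' x
  filter_upwards [(trivializationAt F E x).open_baseSet.mem_nhds hx] with y hy
  simp only [FiberBundle.extend, ← (trivializationAt F E x).symmₗ_apply (R := ℂ) hy]
  rw [← map_add]
  congr 1
  exact ((trivializationAt F E x).linear ℂ hx).map_add u u'

theorem eventually_extend_smul {x : M} (c : ℂ) (u : E x) : ∀ᶠ y in 𝓝 x,
    FiberBundle.extend F (c • u) y = c • FiberBundle.extend F u y := by
  have hx : x ∈ (trivializationAt F E x).baseSet := FiberBundle.mem_baseSet_trivializationAt' x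
  filter_upwards [(trivializationAt F E x).open_baseSet.mem_nhds hx] with y hy
  simp only [FiberBundle.extend, ← (trivializationAt F E x).symmₗ_apply (R := ℂ) hy]
  rw [← map_smul]
  congr 1
  exact ((trivializationAt F E x).linear ℂ hx).map_smul c u

variable [T2Space M]

theorem curvatureField_smul {D : CovariantDerivative (𝓡 n) F E} (hD : IsComplexConnection D)
    (c : ℂ) {x : M} {s t : Π x, E x} (hs : SmoothNear n F s x)
    (ht : SmoothNear n F t x) (hst : ∀ᶠ y in 𝓝 x, t y = c • s y)
    {X Y : Π y : M, TangentSpace (𝓡 n) y}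
    (hX : DiffAt n (EuclideanSpace ℝ (Fin n)) X x) (hY : DiffAt n (EuclideanSpace ℝ (Fin n)) Y x) :
    curvatureField D X Y t x = c • curvatureField D X Y s x := by
  have key : ∀ᶠ y in 𝓝 x, ∀ v, D t y v = c • D s y v := by
    filter_upwards [hs.eventually_diffAt, ht.eventually_diffAt,
      eventually_eventually_nhds.2 hst] with y h1 h2 h3 v
    rw [← hD.complex_linear c h1 v]
    have h4 : DiffAt n F (fun y => c • s y) y := by
      refine MDifferentiableAt.congr_of_eventuallyEq h2 ?_
      filter_upwards [h3] with z hz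
      rw [hz]
    rw [D.isCovariantDerivativeOnUniv.congr_of_eventuallyEq h2 h4 Filter.univ_mem h3]
  have key' (Z : Π y : M, TangentSpace (𝓡 n) y) (hZ : DiffAt n (EuclideanSpace ℝ (Fin n)) Z x)
      (v) : D (fun y => D t y (Z y)) x v = c • D (fun y => D s y (Z y)) x v := by
    have h1 := hs.diffAt_covariantDerivative hD.smooth hZ
    have h2 := ht.diffAt_covariantDerivative hD.smooth hZ
    have h3 : ∀ᶠ y in 𝓝 x, D t y (Z y) = c • D s y (Z y) := by
      filter_upwards [key] with y hy
      exact hy _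
    rw [← hD.complex_linear c h1 v]
    have h4 : DiffAt n F (fun y => c • D s y (Z y)) x := by
      refine MDifferentiableAt.congr_of_eventuallyEq h2 ?_
      filter_upwards [h3] with z hz
      rw [hz]
    rw [D.isCovariantDerivativeOnUniv.congr_of_eventuallyEq h2 h4 Filter.univ_mem h3]
  rw [curvatureField, curvatureField, key' X hX, key' Y hY, key.self_of_nhds, smul_sub, smul_sub]

/-- The curvature endomorphism `R_{v,w}` of `E x`. -/
def curvatureEnd {D : CovariantDerivative (𝓡 n) F E} (hD : IsComplexConnection D) {x : M}
    (v w : TangentSpace (𝓡 n) x) : Module.End ℂ (E x) where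
  toFun u := curvature D v w u
  map_add' u u' := by
    have hv := (smoothNear_extend (n := n) (F := EuclideanSpace ℝ (Fin n))
      v).eventually_diffAt.self_of_nhds
    have hw := (smoothNear_extend (n := n) (F := EuclideanSpace ℝ (Fin n))
      w).eventually_diffAt.self_of_nhds
    have hu := smoothNear_extend (n := n) (F := F) u
    have hu' := smoothNear_extend (n := n) (F := F) u'
    rw [curvature, curvature, curvature, ← curvatureField_add hD.smooth hu hu' hv hw]
    exact curvatureField_congr hD.smooth (smoothNear_extend _) (hu.add hu')
      (eventually_extend_add u u') hv hw
  map_smul' c u := by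
    have hv := (smoothNear_extend (n := n) (F := EuclideanSpace ℝ (Fin n))
      v).eventually_diffAt.self_of_nhds
    have hw := (smoothNear_extend (n := n) (F := EuclideanSpace ℝ (Fin n))
      w).eventually_diffAt.self_of_nhds
    exact curvatureField_smul hD c (smoothNear_extend _) (smoothNear_extend _)
      (eventually_extend_smul c u) hv hw

end ComplexConnection

section Riemannian

variable {n : ℕ} {M : Type*} [TopologicalSpace M]
  [ChartedSpace (EuclideanSpace ℝ (Fin n)) M] [IsManifold (𝓡 n) ∞ M]
  [RiemannianBundle (fun x : M => TangentSpace (𝓡 n) x)]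
  [IsContMDiffRiemannianBundle (𝓡 n) ∞ (EuclideanSpace ℝ (Fin n))
    (fun x : M => TangentSpace (𝓡 n) x)]

/-- Affine connections on `M`. -/
abbrev AffineConnection (n : ℕ) (M : Type*) [TopologicalSpace M]
    [ChartedSpace (EuclideanSpace ℝ (Fin n)) M] [IsManifold (𝓡 n) ∞ M] : Type _ :=
  CovariantDerivative (𝓡 n) (EuclideanSpace ℝ (Fin n)) (fun x : M => TangentSpace (𝓡 n) x)

instance (x : M) : FiniteDimensional ℝ (TangentSpace (𝓡 n) x) :=
  inferInstanceAs (FiniteDimensional ℝ (EuclideanSpace ℝ (Fin n)))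

instance : IsContMDiffRiemannianBundle (𝓡 n) 1 (EuclideanSpace ℝ (Fin n))
    (fun x : M => TangentSpace (𝓡 n) x) :=
  IsContMDiffRiemannianBundle.of_le (n := ∞) (by norm_cast)

/-- The Levi-Civita connection: the smooth, metric, torsion-free connection. -/
structure IsLeviCivita (D : AffineConnection n M) : Prop where
  smooth : D.ContMDiffCovariantDerivative ∞
  metric : D.IsMetricCompatible
  torsion_free : D.torsion = 0

/-- The gradient of a function. -/
def gradient (f : M → ℝ) (x : M) : TangentSpace (𝓡 n) x :=
  ∑ i, mvfderiv (𝓡 n) f x (stdOrthonormalBasis ℝ (TangentSpace (𝓡 n) x) i) •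
    stdOrthonormalBasis ℝ (TangentSpace (𝓡 n) x) i

/-- The Laplacian `Δ f = div ∇f = tr (v ↦ ∇_v ∇f)` of a function. -/
def laplacian (D : AffineConnection n M) (f : M → ℝ) (x : M) : ℝ :=
  LinearMap.trace ℝ (TangentSpace (𝓡 n) x) (D (gradient f) x).toLinearMap

/-- The scalar curvature `∑ i j, ⟨R(b_i, b_j) b_j, b_i⟩`. -/
def scalarCurvature (D : AffineConnection n M) (x : M) : ℝ :=
  let b := stdOrthonormalBasis ℝ (TangentSpace (𝓡 n) x)
  ∑ i, ∑ j, inner ℝ (curvature D (b i) (b j) (b j)) (b i)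

/-- The weighted scalar curvature `R_f = R + 2 Δ f - |∇f|²`. -/
def weightedScalarCurvature (D : AffineConnection n M) (f : M → ℝ) (x : M) : ℝ :=
  scalarCurvature D x + 2 * laplacian D f x - ‖(gradient f x : TangentSpace (𝓡 n) x)‖ ^ 2

end Riemannian

section Twisted

variable {n : ℕ} {M : Type*} [TopologicalSpace M]
  [ChartedSpace (EuclideanSpace ℝ (Fin n)) M] [IsManifold (𝓡 n) ∞ M]
  [RiemannianBundle (fun x : M => TangentSpace (𝓡 n) x)]
  [IsContMDiffRiemannianBundle (𝓡 n) ∞ (EuclideanSpace ℝ (Fin n))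
    (fun x : M => TangentSpace (𝓡 n) x)]
  {o : ManifoldOrientation n M} {σ : SpinStructure o} (ρ : SpinorRep n)
  {F : Type*} [NormedAddCommGroup F] [NormedSpace ℂ F] [FiniteDimensional ℂ F]
  {E : M → Type*} [TopologicalSpace (TotalSpace F E)]
  [∀ x, AddCommGroup (E x)] [∀ x, Module ℂ (E x)] [∀ x, TopologicalSpace (E x)]
  [∀ x, IsTopologicalAddGroup (E x)] [∀ x, ContinuousSMul ℝ (E x)]
  [FiberBundle F E] [VectorBundle ℂ F E] [VectorBundle ℝ F E]
  [ContMDiffVectorBundle ∞ F E (𝓡 n)]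

/-- The component `E x` of `Σ_n ⊗ E x` at a vector of the standard basis of `Σ_n`. -/
def component {x : M} (a : Fin (2 ^ (n / 2))) (t : Spinor n ⊗[ℂ] E x) : E x :=
  TensorProduct.lid ℂ (E x) (LinearMap.rTensor (E x) (LinearMap.proj a) t)

variable (σ E) in
/-- A not necessarily smooth section of the twisted spin bundle `Σ_E = ΣM ⊗ E`. -/
abbrev TwistedSpinor : Type _ := Π x : M, SpinorFiber σ ρ x ⊗[ℂ] E x

variable (σ E) in
/-- Families of local representatives, one for each spin gauge, with values in `Σ_n ⊗ E`. A section
of `ΣM ⊗ E` is determined by the family of its local representatives on the domains of the gauges,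
and differential operators on sections act on local representatives, gauge by gauge. Values of the
representatives outside the domains are irrelevant. -/
abbrev GaugeField : Type _ := SpinGauge σ → Π x : M, Spinor n ⊗[ℂ] E x

variable {ρ} in
/-- The local representatives of a section `Ψ` of `ΣM ⊗ E`: in a gauge `G`, the fibre of `ΣM` at `x`
is identified with `Σ_n` by evaluation at `G.lift x`, that is by `[G.lift x, ψ] ↦ ψ`. -/
def TwistedSpinor.rep (Ψ : TwistedSpinor σ ρ E) : GaugeField σ E := fun G x =>
  LinearMap.rTensor (E x) (LinearMap.proj (G.lift x) ∘ₗ (SpinorFiber σ ρ x).subtype) (Ψ x)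

variable {ρ} in
/-- A section of `ΣM ⊗ E` is smooth if its components in every spin gauge are smooth sections
of `E`. -/
def TwistedSpinor.IsSmooth (F : Type*) [NormedAddCommGroup F] [NormedSpace ℂ F]
    [TopologicalSpace (TotalSpace F E)] [FiberBundle F E] (Ψ : TwistedSpinor σ ρ E) : Prop :=
  ∀ (G : SpinGauge σ) (a : Fin (2 ^ (n / 2))),
    ContMDiffOn (𝓡 n) ((𝓡 n).prod 𝓘(ℝ, F)) ∞
      (fun x => TotalSpace.mk' F x (component a (Ψ.rep G x))) G.domain

/-- Clifford multiplication `ψ ↦ v · ψ` in a spin gauge. -/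
def clifford (G : SpinGauge σ) {x : M} (v : TangentSpace (𝓡 n) x) : Module.End ℂ (Spinor n) :=
  ρ (vec (fun i => inner ℝ (G.frame i x) v))

/-- The connection form `¼ ∑ i j, ⟨∇_v e_i, e_j⟩ e_i · e_j ·` of the spin connection in a spin gauge
with orthonormal frame `e`. -/
def spinConnectionForm (D : AffineConnection n M) (G : SpinGauge σ) {x : M}
    (v : TangentSpace (𝓡 n) x) : Module.End ℂ (Spinor n) :=
  (1 / 4 : ℂ) • ∑ i, ∑ j, ((inner ℝ (D (G.frame i) x v) (G.frame j x) : ℝ) : ℂ) •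
    (clifford ρ G (G.frame i x) * clifford ρ G (G.frame j x))

/-- The tensor product connection `∇_v` on `ΣM ⊗ E` of the spin connection and the connection `DE`,
in spin gauges. -/
def twistedConnection (D : AffineConnection n M) (DE : CovariantDerivative (𝓡 n) F E)
    (φ : GaugeField σ E) (G : SpinGauge σ) (x : M) (v : TangentSpace (𝓡 n) x) :
    Spinor n ⊗[ℂ] E x :=
  ∑ a, (Pi.single a 1 : Spinor n) ⊗ₜ[ℂ] DE (fun y => component a (φ G y)) x v
    + LinearMap.rTensor (E x) (spinConnectionForm ρ D G v) (φ G x)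

/-- The twisted Dirac operator `D_E = ∑ i, e_i · ∇_{e_i}`. -/
def twistedDirac (D : AffineConnection n M) (DE : CovariantDerivative (𝓡 n) F E)
    (φ : GaugeField σ E) : GaugeField σ E := fun G x =>
  ∑ i, LinearMap.rTensor (E x) (clifford ρ G (G.frame i x))
    (twistedConnection ρ D DE φ G x (G.frame i x))

/-- Multiplication of a section by a real function. -/
def mulFun (h : M → ℝ) (φ : GaugeField σ E) : GaugeField σ E := fun G x => (h x : ℂ) • φ G x

/-- The weighted twisted Dirac operator `D_{E,f} = e^{f/2} D_E e^{-f/2}`. -/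
def weightedTwistedDirac (D : AffineConnection n M) (DE : CovariantDerivative (𝓡 n) F E)
    (f : M → ℝ) (φ : GaugeField σ E) : GaugeField σ E :=
  mulFun (fun x => Real.exp (f x / 2))
    (twistedDirac ρ D DE (mulFun (fun x => Real.exp (-f x / 2)) φ))

/-- The connection Laplacian `Δ = ∑ i, (∇_{e_i} ∇_{e_i} - ∇_{∇_{e_i} e_i})` on `ΣM ⊗ E`. -/
def connectionLaplacian (D : AffineConnection n M) (DE : CovariantDerivative (𝓡 n) F E)
    (φ : GaugeField σ E) : GaugeField σ E := fun G x =>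
  ∑ i, (twistedConnection ρ D DE
      (fun G' y => twistedConnection ρ D DE φ G' y (G'.frame i y)) G x (G.frame i x)
    - twistedConnection ρ D DE φ G x (D (G.frame i) x (G.frame i x)))

/-- The weighted connection Laplacian `Δ_f = Δ - ∇_{∇f}` on `ΣM ⊗ E`. -/
def weightedConnectionLaplacian (D : AffineConnection n M) (DE : CovariantDerivative (𝓡 n) F E)
    (f : M → ℝ) (φ : GaugeField σ E) : GaugeField σ E := fun G x =>
  connectionLaplacian ρ D DE φ G x - twistedConnection ρ D DE φ G x (gradient f x)

/-- The endomorphism `½ ∑ i j, e_i · e_j · ⊗ R^E_{e_i, e_j}` of `ΣM ⊗ E`. -/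
def twistingCurvature [T2Space M] {DE : CovariantDerivative (𝓡 n) F E}
    (hDE : IsComplexConnection DE) (φ : GaugeField σ E) : GaugeField σ E := fun G x =>
  (1 / 2 : ℂ) • ∑ i, ∑ j,
    TensorProduct.map (clifford ρ G (G.frame i x) * clifford ρ G (G.frame j x))
      (curvatureEnd hDE (G.frame i x) (G.frame j x)) (φ G x)

end Twisted

end

end WeightedSpin

/-! The inner exponentials in the square of D_{E,f} cancel, so D_{E,f}² = e^{f/2} D_E² e^{-f/2}
(`weightedTwistedDirac_sq_eq`). The theorem is therefore the unweighted Lichnerowicz formula applied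
to gΨ with g = e^{-f/2}. The zeroth order terms commute with g, and the Laplacian satisfies Δ(gΨ) =
gΔΨ + 2∇_{∇g}Ψ + (Δg)Ψ (`sum_secondDerivative_real_smul`). Since ∇g = -½ g∇f and Δg = g(-½Δf +
¼|∇f|²), the term -e^{f/2}Δ(gΨ) equals -ΔΨ + ∇_{∇f}Ψ + ¼(2Δf - |∇f|²)Ψ. This is -Δ_f together with
the correction from R to R_f.

For the unweighted formula (`lichnerowicz`), work in one spin gauge. Clifford multiplication by the
frame vectors is then given by constant matrices c_i. The twisted spin connection is the trivial
connection on Σ_n tensored with the connection of E, plus the matrix ¼ Σ ω_kl c_k c_l. Clifford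
multiplication is parallel (`spinConnection_clifford`), hence D_E² = Σ c_i c_j ∇²_ij. By the
Clifford relations the part of ∇² symmetric in i, j contributes -Δ. The antisymmetric part is half
the curvature, which splits into R^E and ¼ Σ R_ijkl c_k c_l (`spinConnection_curvature`). The first
piece is the twisting term, and the first Bianchi identity collapses the contraction of the second
to the scalar R/4 (`CliffordRelations.curvature_contraction`).

The frame is an arbitrary orthonormal one, not normal at the point, so Christoffel terms are carried
along and cancel by antisymmetry of ω. Curvature enters both as an operator on fields and as a
tensor at a point; tensoriality identifies the two. Regularity and derivatives on Σ_n ⊗ E are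
handled through the E-valued components in the standard basis of Σ_n. -/

namespace WeightedSpin

noncomputable section

set_option linter.unusedSectionVars false

/-! ### Local smoothness, derivatives along vector fields and Lie brackets. -/

section FunctionsAndFields

variable {n : ℕ} {M : Type*} [TopologicalSpace M]
  [ChartedSpace (EuclideanSpace ℝ (Fin n)) M] [IsManifold (𝓡 n) ∞ M]

/-- A real function is smooth near a point. -/
def FunSmoothNear (g : M → ℝ) (x : M) : Prop :=
  ∃ U ∈ 𝓝 x, ContMDiffOn (𝓡 n) 𝓘(ℝ, ℝ) ∞ g U

/-- A real function is differentiable at a point. -/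
def FunDiffAt (g : M → ℝ) (x : M) : Prop := MDifferentiableAt (𝓡 n) 𝓘(ℝ, ℝ) g x

theorem FunSmoothNear.eventually {g : M → ℝ} {x : M} (hg : FunSmoothNear (n := n) g x) :
    ∀ᶠ y in 𝓝 x, FunSmoothNear (n := n) g y := by
  obtain ⟨U, hU, h⟩ := hg
  filter_upwards [eventually_eventually_nhds.2 hU] with y hy using ⟨U, hy, h⟩

theorem FunSmoothNear.diffAt {g : M → ℝ} {x : M} (hg : FunSmoothNear (n := n) g x) :
    FunDiffAt (n := n) g x := by
  obtain ⟨U, hU, h⟩ := hg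
  exact (h.contMDiffAt hU).mdifferentiableAt (by simp)

theorem mvfderiv_congr_of_eventuallyEq {g h : M → ℝ} {x : M} (H : ∀ᶠ y in 𝓝 x, g y = h y) :
    mvfderiv (𝓡 n) g x = mvfderiv (𝓡 n) h x := by
  have H' : g =ᶠ[𝓝 x] h := H
  ext v
  simp only [mvfderiv, H'.mfderiv_eq]
  rfl

section

variable {F : Type*} [NormedAddCommGroup F] [NormedSpace ℝ F]
  {V : M → Type*} [TopologicalSpace (TotalSpace F V)]
  [∀ x, AddCommGroup (V x)] [∀ x, Module ℝ (V x)] [∀ x, TopologicalSpace (V x)]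
  [∀ x, IsTopologicalAddGroup (V x)] [∀ x, ContinuousSMul ℝ (V x)]
  [FiberBundle F V]

theorem SmoothNear.eventually {s : Π x, V x} {x : M} (hs : SmoothNear n F s x) :
    ∀ᶠ y in 𝓝 x, SmoothNear n F s y := by
  obtain ⟨U, hU, h⟩ := hs
  filter_upwards [eventually_eventually_nhds.2 hU] with y hy using ⟨U, hy, h⟩

theorem SmoothNear.contMDiffAt {s : Π x, V x} {x : M} (hs : SmoothNear n F s x) :
    ContMDiffAt (𝓡 n) ((𝓡 n).prod 𝓘(ℝ, F)) ∞ (fun y => TotalSpace.mk' F y (s y)) x := by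
  obtain ⟨U, hU, h⟩ := hs
  exact h.contMDiffAt hU

theorem SmoothNear.diffAt [VectorBundle ℝ F V] {s : Π x, V x} {x : M}
    (hs : SmoothNear n F s x) : DiffAt n F s x :=
  hs.eventually_diffAt.self_of_nhds

theorem SmoothNear.congr {s t : Π x, V x} {x : M} (hs : SmoothNear n F s x)
    (h : ∀ᶠ y in 𝓝 x, t y = s y) : SmoothNear n F t x := by
  obtain ⟨U, hU, hs⟩ := hs
  refine ⟨U ∩ {y | t y = s y}, Filter.inter_mem hU h, fun y hy => ?_⟩
  refine ((hs y hy.1).mono Set.inter_subset_left).congr (fun z hz => ?_) ?_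
  · rw [hz.2]
  · rw [hy.2]

theorem DiffAt.congr {s t : Π x, V x} {x : M} (hs : DiffAt n F s x)
    (h : ∀ᶠ y in 𝓝 x, t y = s y) : DiffAt n F t x :=
  MDifferentiableAt.congr_of_eventuallyEq hs (h.mono fun y hy => by simp only [hy])

theorem SmoothNear.smul [VectorBundle ℝ F V] {g : M → ℝ} {s : Π x, V x} {x : M}
    (hg : FunSmoothNear (n := n) g x) (hs : SmoothNear n F s x) : SmoothNear n F (g • s) x := by
  obtain ⟨U, hU, hg⟩ := hg
  obtain ⟨W, hW, hs⟩ := hs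
  exact ⟨U ∩ W, Filter.inter_mem hU hW,
    (hg.mono Set.inter_subset_left).smul_section (hs.mono Set.inter_subset_right)⟩

theorem SmoothNear.sum [VectorBundle ℝ F V] {ι : Type*} (I : Finset ι) {s : ι → Π x, V x} {x : M}
    (hs : ∀ i, SmoothNear n F (s i) x) : SmoothNear n F (fun y => ∑ i ∈ I, s i y) x := by
  choose U hU h using hs
  refine ⟨⋂ i ∈ I, U i, (Filter.biInter_finset_mem I).2 fun i _ => hU i, ?_⟩
  exact ContMDiffOn.sum_section fun i hi => (h i).mono (Set.biInter_subset_of_mem hi)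

end

theorem isManifold_minSmoothness {k : WithTop ℕ∞} (hk : k ≤ ∞) :
    IsManifold (𝓡 n) (minSmoothness ℝ k) M := by
  simpa using IsManifold.of_le (I := 𝓡 n) (M := M) hk

/-- The derivative of a smooth function along a smooth vector field is smooth. -/
theorem FunSmoothNear.mvfderiv {g : M → ℝ} {x : M} (hg : FunSmoothNear (n := n) g x)
    {X : Π y : M, TangentSpace (𝓡 n) y} (hX : SmoothNear n (EuclideanSpace ℝ (Fin n)) X x) :
    FunSmoothNear (n := n) (fun y => mvfderiv (𝓡 n) g y (X y)) x := by
  obtain ⟨U, hU, hg⟩ := hg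
  obtain ⟨W, hW, hX⟩ := hX
  obtain ⟨O, hO, hOo, hxO⟩ := mem_nhds_iff.1 (Filter.inter_mem hU hW)
  refine ⟨O, hOo.mem_nhds hxO, ?_⟩
  have h1 := (hg.mono (hO.trans Set.inter_subset_left)).contMDiffOn_tangentMapWithin
    (m := ∞) (by simp) hOo.uniqueMDiffOn
  have h2 := h1.comp (hX.mono (hO.trans Set.inter_subset_right)) (fun y hy => hy)
  have h3 := (contMDiff_snd_tangentBundle_modelSpace ℝ 𝓘(ℝ, ℝ) (n := ∞)).comp_contMDiffOn h2
  refine h3.congr fun y hy => ?_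
  change _ = (mfderivWithin (𝓡 n) 𝓘(ℝ, ℝ) g O y) (X y)
  rw [mfderivWithin_of_isOpen hOo hy]
  rfl

theorem SmoothNear.mlieBracket {X Y : Π y : M, TangentSpace (𝓡 n) y} {x : M}
    (hX : SmoothNear n (EuclideanSpace ℝ (Fin n)) X x)
    (hY : SmoothNear n (EuclideanSpace ℝ (Fin n)) Y x) :
    SmoothNear n (EuclideanSpace ℝ (Fin n)) (VectorField.mlieBracket (𝓡 n) X Y) x := by
  have h := hX.eventually.and hY.eventually
  have : IsManifold (𝓡 n) (minSmoothness ℝ 2) M :=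
    isManifold_minSmoothness (WithTop.coe_le_coe.2 (le_top : (2 : ℕ∞) ≤ ⊤))
  -- The bracket costs one derivative, which is harmless because ∞ + 1 = ∞.
  have : IsManifold (𝓡 n) (((⊤ : ℕ∞) : WithTop ℕ∞) + 1) M := by
    rw [show ((⊤ : ℕ∞) : WithTop ℕ∞) + 1 = ∞ from rfl]
    infer_instance
  refine ⟨_, h, fun y hy => ?_⟩
  exact (ContMDiffAt.mlieBracket_vectorField (m := ⊤) (n := ⊤) hy.1.contMDiffAt hy.2.contMDiffAt
    (by simp)).contMDiffWithinAt

theorem jacobi_mlieBracket {X Y Z : Π y : M, TangentSpace (𝓡 n) y} {x : M}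
    (hX : SmoothNear n (EuclideanSpace ℝ (Fin n)) X x)
    (hY : SmoothNear n (EuclideanSpace ℝ (Fin n)) Y x)
    (hZ : SmoothNear n (EuclideanSpace ℝ (Fin n)) Z x) :
    VectorField.mlieBracket (𝓡 n) X (VectorField.mlieBracket (𝓡 n) Y Z) x =
      VectorField.mlieBracket (𝓡 n) (VectorField.mlieBracket (𝓡 n) X Y) Z x +
      VectorField.mlieBracket (𝓡 n) Y (VectorField.mlieBracket (𝓡 n) X Z) x := by
  have : IsManifold (𝓡 n) (minSmoothness ℝ 3) M :=
    isManifold_minSmoothness (WithTop.coe_le_coe.2 (le_top : (3 : ℕ∞) ≤ ⊤))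
  have h2 : minSmoothness ℝ 2 ≤ (∞ : WithTop ℕ∞) := by
    rw [minSmoothness_of_isRCLikeNormedField]
    exact WithTop.coe_le_coe.2 (le_top : (2 : ℕ∞) ≤ ⊤)
  exact VectorField.leibniz_identity_mlieBracket_apply (hX.contMDiffAt.of_le h2)
    (hY.contMDiffAt.of_le h2) (hZ.contMDiffAt.of_le h2)

/-- The Lie bracket as a commutator of derivations. -/
theorem mvfderiv_mlieBracket {g : M → ℝ} {X Y : Π y : M, TangentSpace (𝓡 n) y} {x : M}
    (hg : FunSmoothNear (n := n) g x)
    (hX : SmoothNear n (EuclideanSpace ℝ (Fin n)) X x)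
    (hY : SmoothNear n (EuclideanSpace ℝ (Fin n)) Y x) :
    mvfderiv (𝓡 n) g x (VectorField.mlieBracket (𝓡 n) X Y x) =
      mvfderiv (𝓡 n) (fun y => mvfderiv (𝓡 n) g y (Y y)) x (X x) -
      mvfderiv (𝓡 n) (fun y => mvfderiv (𝓡 n) g y (X y)) x (Y x) := by
  rcases subsingleton_or_nontrivial (TangentSpace (𝓡 n) x) with h | h
  · have hz (v : TangentSpace (𝓡 n) x) : v = 0 := Subsingleton.elim _ _
    rw [hz (VectorField.mlieBracket (𝓡 n) X Y x), hz (X x), hz (Y x)]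
    simp
  -- Compare the Jacobi identity for X, Y, gZ with the one for X, Y, Z. What remains is (XYg - YXg -
  -- [X,Y]g) Z = 0, so a field Z that does not vanish at `x` detects the coefficient. This is why
  -- the zero tangent space is treated apart.
  obtain ⟨z, hz⟩ := exists_ne (0 : TangentSpace (𝓡 n) x)
  set Z : Π y : M, TangentSpace (𝓡 n) y := FiberBundle.extend (EuclideanSpace ℝ (Fin n)) z
  have hZ : SmoothNear n (EuclideanSpace ℝ (Fin n)) Z x := smoothNear_extend z
  have hZx : Z x = z := by simp [Z]
  have bracket {W : Π y : M, TangentSpace (𝓡 n) y}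
      (hW : SmoothNear n (EuclideanSpace ℝ (Fin n)) W x) :
      VectorField.mlieBracket (𝓡 n) W (g • Z) =ᶠ[𝓝 x]
        (fun y => mvfderiv (𝓡 n) g y (W y)) • Z + g • VectorField.mlieBracket (𝓡 n) W Z := by
    filter_upwards [hg.eventually, hZ.eventually] with y h1 h2
    exact VectorField.mlieBracket_smul_right h1.diffAt h2.diffAt
  have second {W W' : Π y : M, TangentSpace (𝓡 n) y}
      (hW : SmoothNear n (EuclideanSpace ℝ (Fin n)) W x)
      (hW' : SmoothNear n (EuclideanSpace ℝ (Fin n)) W' x) :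
      VectorField.mlieBracket (𝓡 n) W (VectorField.mlieBracket (𝓡 n) W' (g • Z)) x =
        mvfderiv (𝓡 n) (fun y => mvfderiv (𝓡 n) g y (W' y)) x (W x) • z
        + mvfderiv (𝓡 n) g x (W' x) • VectorField.mlieBracket (𝓡 n) W Z x
        + (mvfderiv (𝓡 n) g x (W x) • VectorField.mlieBracket (𝓡 n) W' Z x
          + g x • VectorField.mlieBracket (𝓡 n) W (VectorField.mlieBracket (𝓡 n) W' Z) x) := by
    rw [Filter.EventuallyEq.mlieBracket_vectorField_eq (V₁ := W) (V := W) Filter.EventuallyEq.rfl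
        (bracket hW'),
      VectorField.mlieBracket_add_right (SmoothNear.smul (hg.mvfderiv hW') hZ).diffAt
        (SmoothNear.smul hg (hW'.mlieBracket hZ)).diffAt,
      VectorField.mlieBracket_smul_right (hg.mvfderiv hW').diffAt hZ.diffAt,
      VectorField.mlieBracket_smul_right hg.diffAt (hW'.mlieBracket hZ).diffAt, hZx]
  have hJ := jacobi_mlieBracket hX hY (SmoothNear.smul hg hZ)
  have hJ' := jacobi_mlieBracket hX hY hZ
  rw [second hX hY, second hY hX, (bracket (hX.mlieBracket hY)).self_of_nhds, hJ'] at hJ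
  simp only [Pi.add_apply, Pi.smul_apply', hZx] at hJ
  have h0 : (mvfderiv (𝓡 n) (fun y => mvfderiv (𝓡 n) g y (Y y)) x (X x) -
      mvfderiv (𝓡 n) (fun y => mvfderiv (𝓡 n) g y (X y)) x (Y x) -
      mvfderiv (𝓡 n) g x (VectorField.mlieBracket (𝓡 n) X Y x)) • z = 0 := by
    rw [sub_smul, sub_smul]
    rw [← sub_eq_zero] at hJ
    rw [← hJ]
    module
  rcases smul_eq_zero.1 h0 with h1 | h1
  · linarith
  · exact absurd h1 hz

end FunctionsAndFields

/-! ### Tensoriality of the curvature of a connection. -/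

section Tensoriality

variable {n : ℕ} {M : Type*} [TopologicalSpace M] [T2Space M]
  [ChartedSpace (EuclideanSpace ℝ (Fin n)) M] [IsManifold (𝓡 n) ∞ M]
  {F : Type*} [NormedAddCommGroup F] [NormedSpace ℝ F]
  {V : M → Type*} [TopologicalSpace (TotalSpace F V)]
  [∀ x, AddCommGroup (V x)] [∀ x, Module ℝ (V x)] [∀ x, TopologicalSpace (V x)]
  [∀ x, IsTopologicalAddGroup (V x)] [∀ x, ContinuousSMul ℝ (V x)]
  [FiberBundle F V] [VectorBundle ℝ F V] [ContMDiffVectorBundle ∞ F V (𝓡 n)]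
  {D : CovariantDerivative (𝓡 n) F V}

theorem curvatureField_antisymm (X Y : Π y : M, TangentSpace (𝓡 n) y) (s : Π y, V y) (x : M) :
    curvatureField D X Y s x = -curvatureField D Y X s x := by
  rw [curvatureField, curvatureField, VectorField.mlieBracket_swap_apply, map_neg]
  abel

/-- When X is replaced by fX, the term Y(f) ∇_X s produced by the Leibniz rule is cancelled by [fX,
Y] = f[X, Y] - Y(f) X. -/
theorem tensorialAt_curvatureField (hD : D.ContMDiffCovariantDerivative ∞) {x : M}
    {s : Π y, V y} (hs : SmoothNear n F s x) (Y : Π y : M, TangentSpace (𝓡 n) y) :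
    TensorialAt (𝓡 n) (EuclideanSpace ℝ (Fin n)) (fun X => curvatureField D X Y s x) x where
  smul {f X} hf hX := by
    have h : (fun y => D s y ((f • X) y)) = f • fun y => D s y (X y) := by
      ext y
      simp
    simp only [curvatureField]
    rw [h, D.isCovariantDerivativeOnUniv.leibniz (hs.diffAt_covariantDerivative hD hX) hf,
      VectorField.mlieBracket_smul_left hf hX]
    simp
    module
  add {X X'} hX hX' := by
    have h : (fun y => D s y ((X + X') y)) = (fun y => D s y (X y)) + fun y => D s y (X' y) := by
      ext y
      simp
    simp only [curvatureField]
    rw [h, D.isCovariantDerivativeOnUniv.add (hs.diffAt_covariantDerivative hD hX)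
      (hs.diffAt_covariantDerivative hD hX'), VectorField.mlieBracket_add_left hX hX']
    simp
    abel

/-- The mixed first order terms are symmetric in X and Y and drop out. The second derivatives of g
antisymmetrise to [X, Y]g, which the bracket term of the curvature removes. -/
theorem curvatureField_smul_section (hD : D.ContMDiffCovariantDerivative ∞) {x : M}
    {s : Π y, V y} (hs : SmoothNear n F s x) {g : M → ℝ} (hg : FunSmoothNear (n := n) g x)
    {X Y : Π y : M, TangentSpace (𝓡 n) y}
    (hX : SmoothNear n (EuclideanSpace ℝ (Fin n)) X x)
    (hY : SmoothNear n (EuclideanSpace ℝ (Fin n)) Y x) :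
    curvatureField D X Y (g • s) x = g x • curvatureField D X Y s x := by
  have second {W W' : Π y : M, TangentSpace (𝓡 n) y}
      (hW' : SmoothNear n (EuclideanSpace ℝ (Fin n)) W' x) :
      D (fun y => D (g • s) y (W' y)) x (W x) =
        g x • D (fun y => D s y (W' y)) x (W x)
        + mvfderiv (𝓡 n) g x (W x) • D s x (W' x)
        + (mvfderiv (𝓡 n) g x (W' x) • D s x (W x)
          + mvfderiv (𝓡 n) (fun y => mvfderiv (𝓡 n) g y (W' y)) x (W x) • s x) := by
    have h1 := hs.diffAt_covariantDerivative hD hW'.diffAt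
    have h2 : ∀ᶠ y in 𝓝 x, D (g • s) y (W' y) =
        (g • (fun y => D s y (W' y)) + (fun y => mvfderiv (𝓡 n) g y (W' y)) • s) y := by
      filter_upwards [hg.eventually, hs.eventually] with y h1 h2
      rw [D.isCovariantDerivativeOnUniv.leibniz h2.diffAt h1.diffAt]
      simp
    have h3 : DiffAt n F (g • (fun y => D s y (W' y))) x :=
      MDifferentiableAt.smul_section hg.diffAt h1
    have h4 : DiffAt n F ((fun y => mvfderiv (𝓡 n) g y (W' y)) • s) x :=
      MDifferentiableAt.smul_section (hg.mvfderiv hW').diffAt hs.diffAt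
    have h5 : DiffAt n F
        (g • (fun y => D s y (W' y)) + (fun y => mvfderiv (𝓡 n) g y (W' y)) • s) x :=
      mdifferentiableAt_add_section h3 h4
    rw [D.isCovariantDerivativeOnUniv.congr_of_eventuallyEq (h5.congr h2) h5 Filter.univ_mem h2,
      D.isCovariantDerivativeOnUniv.add h3 h4, D.isCovariantDerivativeOnUniv.leibniz h1 hg.diffAt,
      D.isCovariantDerivativeOnUniv.leibniz hs.diffAt (hg.mvfderiv hW').diffAt]
    simp
  rw [curvatureField, second hY, second hX,
    D.isCovariantDerivativeOnUniv.leibniz hs.diffAt hg.diffAt, curvatureField]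
  simp only [add_apply, smul_apply, ContinuousLinearMap.smulRight_apply,
    mvfderiv_mlieBracket hg hX hY]
  module

theorem curvatureField_sum_section (hD : D.ContMDiffCovariantDerivative ∞) {x : M}
    {ι : Type*} (I : Finset ι) {s : ι → Π y, V y} (hs : ∀ i, SmoothNear n F (s i) x)
    {X Y : Π y : M, TangentSpace (𝓡 n) y}
    (hX : DiffAt n (EuclideanSpace ℝ (Fin n)) X x) (hY : DiffAt n (EuclideanSpace ℝ (Fin n)) Y x) :
    curvatureField D X Y (fun y => ∑ i ∈ I, s i y) x = ∑ i ∈ I, curvatureField D X Y (s i) x := by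
  classical
  induction I using Finset.induction_on with
  | empty =>
    have h0 : SmoothNear n F (fun y => ∑ i ∈ (∅ : Finset ι), s i y) x := SmoothNear.sum _ hs
    have h := curvatureField_add hD h0 h0 hX hY
    -- The zero section z satisfies z + z = z, so additivity alone forces its curvature to vanish.
    have h' : (fun y => ∑ i ∈ (∅ : Finset ι), s i y) + (fun y => ∑ i ∈ (∅ : Finset ι), s i y) =
      fun y => ∑ i ∈ (∅ : Finset ι), s i y := by ext; simp
    rw [h'] at h
    simpa using h
  | insert a I ha ih =>
    have h' : (fun y => ∑ i ∈ insert a I, s i y) = s a + fun y => ∑ i ∈ I, s i y := by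
      ext; simp [ha]
    rw [h', curvatureField_add hD (hs a) (SmoothNear.sum _ hs) hX hY, ih, Finset.sum_insert ha]

variable [FiniteDimensional ℝ F]

/-- Near x a section is a combination of a local frame with smooth coefficients. Function-linearity
reduces its curvature at x to the values of these coefficients at x. -/
theorem curvatureField_congr_section (hD : D.ContMDiffCovariantDerivative ∞) {x : M}
    {s t : Π y, V y} (hs : SmoothNear n F s x) (ht : SmoothNear n F t x) (hst : s x = t x)
    {X Y : Π y : M, TangentSpace (𝓡 n) y}
    (hX : SmoothNear n (EuclideanSpace ℝ (Fin n)) X x)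
    (hY : SmoothNear n (EuclideanSpace ℝ (Fin n)) Y x) :
    curvatureField D X Y s x = curvatureField D X Y t x := by
  have : ContMDiffVectorBundle 1 F V (𝓡 n) :=
    ContMDiffVectorBundle.of_le (n := ∞) (by exact_mod_cast le_top)
  let e := trivializationAt F V x
  have hxe : x ∈ e.baseSet := FiberBundle.mem_baseSet_trivializationAt F V x
  let b := Basis.ofVectorSpace ℝ F
  have hb (i) : SmoothNear n F (e.localFrame b i) x :=
    ⟨e.baseSet, e.open_baseSet.mem_nhds hxe, e.contMDiffOn_localFrame_baseSet ∞ b i⟩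
  have key {s : Π y, V y} (hs : SmoothNear n F s x) : curvatureField D X Y s x =
      ∑ i, e.localFrameCoeff (𝓡 n) b i x (s x) • curvatureField D X Y (e.localFrame b i) x := by
    have hc (i) : FunSmoothNear (n := n) (fun y => e.localFrameCoeff (𝓡 n) b i y (s y)) x := by
      refine ⟨_, hs.eventually.and (e.open_baseSet.mem_nhds hxe), fun y hy => ?_⟩
      exact (contMDiffAt_localFrameCoeff b hy.2 hy.1.contMDiffAt i).contMDiffWithinAt
    have h1 (i) := SmoothNear.smul (hc i) (hb i)
    rw [curvatureField_congr hD hs (SmoothNear.sum Finset.univ h1)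
      (e.eventually_eq_localFrame_sum_coeff_smul b hxe) hX.diffAt hY.diffAt,
      curvatureField_sum_section hD _ h1 hX.diffAt hY.diffAt]
    exact Finset.sum_congr rfl fun i _ => curvatureField_smul_section hD (hb i) (hc i) hX hY
  rw [key hs, key ht, hst]

/-- `curvature` uses one particular local extension of each argument. The arguments are exchanged
for these one at a time: X by tensoriality, Y by the same after a swap, and the section by the
preceding lemma. -/
theorem curvatureField_eq_curvature (hD : D.ContMDiffCovariantDerivative ∞) {x : M}
    {s : Π y, V y} (hs : SmoothNear n F s x)
    {X Y : Π y : M, TangentSpace (𝓡 n) y}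
    (hX : SmoothNear n (EuclideanSpace ℝ (Fin n)) X x)
    (hY : SmoothNear n (EuclideanSpace ℝ (Fin n)) Y x) :
    curvatureField D X Y s x = curvature D (X x) (Y x) (s x) := by
  have hX' := smoothNear_extend (n := n) (F := EuclideanSpace ℝ (Fin n)) (X x)
  have hY' := smoothNear_extend (n := n) (F := EuclideanSpace ℝ (Fin n)) (Y x)
  rw [curvature, (tensorialAt_curvatureField hD hs _).pointwise hX.diffAt hX'.diffAt
    (by simp), curvatureField_antisymm,
    (tensorialAt_curvatureField hD hs _).pointwise hY.diffAt hY'.diffAt (by simp),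
    curvatureField_antisymm, neg_neg]
  exact curvatureField_congr_section hD hs (smoothNear_extend _) (by simp) hX' hY'

end Tensoriality

/-! ### Clifford algebra: the spin Lie algebra and the contraction of curvature. -/

section CliffordRelations

variable {ι : Type*} [Fintype ι] [DecidableEq ι] {A : Type*} [Ring A] [Algebra ℂ A]

/-- The relations `c_i c_j + c_j c_i = -2 δ_ij`. -/
def CliffordRelations (c : ι → A) : Prop :=
  ∀ i j, c i * c j + c j * c i = (if i = j then (-2 : ℂ) else 0) • (1 : A)

/-- The element `¼ ∑ k l, w_kl c_k c_l` of the Lie algebra of the spin group. -/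
def spinElement (c : ι → A) (w : ι → ι → ℂ) : A :=
  (1 / 4 : ℂ) • ∑ k, ∑ l, w k l • (c k * c l)

variable {c : ι → A}

theorem CliffordRelations.swap (hc : CliffordRelations c) (i j : ι) :
    c i * c j = (if i = j then (-2 : ℂ) else 0) • (1 : A) - c j * c i := by
  rw [← hc i j]
  abel

theorem CliffordRelations.mul_commutator (hc : CliffordRelations c) (k l m : ι) :
    c k * c l * c m - c m * (c k * c l) =
      (if l = m then (-2 : ℂ) else 0) • c k - (if k = m then (-2 : ℂ) else 0) • c l := by
  rw [mul_assoc, hc.swap l m, ← mul_assoc, eq_sub_of_add_eq' (hc k m)]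
  simp only [mul_sub, sub_mul, mul_smul_comm, smul_mul_assoc, mul_one, one_mul, mul_assoc]
  abel

/-- Infinitesimal form of the covering Spin(n) → SO(n). Each of the two index matches contributes 2
Σ w_mj c_j by antisymmetry of w, and the factor ¼ normalises their sum. -/
theorem CliffordRelations.spinElement_commutator (hc : CliffordRelations c) {w : ι → ι → ℂ}
    (hw : ∀ k l, w k l = -w l k) (m : ι) :
    spinElement c w * c m - c m * spinElement c w = ∑ j, w m j • c j := by
  have h : spinElement c w * c m - c m * spinElement c w =
      (1 / 4 : ℂ) • ∑ k, ∑ l, w k l • (c k * c l * c m - c m * (c k * c l)) := by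
    simp only [spinElement, smul_mul_assoc, mul_smul_comm, Finset.sum_mul, Finset.mul_sum,
      ← smul_sub, ← Finset.sum_sub_distrib]
  rw [h]
  simp only [hc.mul_commutator, smul_sub, Finset.sum_sub_distrib, ite_smul, zero_smul, smul_ite,
    smul_zero, Finset.sum_ite_eq', Finset.mem_univ, if_true]
  rw [Finset.sum_comm]
  simp only [Finset.sum_ite_eq', Finset.mem_univ, if_true]
  rw [Finset.smul_sum, Finset.smul_sum, ← Finset.sum_sub_distrib]
  refine Finset.sum_congr rfl fun j _ => ?_
  rw [hw j m]
  module

/-- The commutator with a spin element is a derivation, so its action on c_k c_l follows from its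
action on generators. The index order on the right is that of the quadratic term in the structure
equation `inner_curvatureField_eq`. -/
theorem CliffordRelations.spinElement_bracket (hc : CliffordRelations c) {v w : ι → ι → ℂ}
    (hv : ∀ k l, v k l = -v l k) (hw : ∀ k l, w k l = -w l k) :
    spinElement c v * spinElement c w - spinElement c w * spinElement c v =
      spinElement c (fun k l => ∑ m, (v k m * w l m - w k m * v l m)) := by
  have h1 (k l : ι) : spinElement c v * (c k * c l) - c k * c l * spinElement c v =
      ∑ m, (v k m • (c m * c l) + v l m • (c k * c m)) := by
    have e : spinElement c v * (c k * c l) - c k * c l * spinElement c v =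
        (spinElement c v * c k - c k * spinElement c v) * c l
          + c k * (spinElement c v * c l - c l * spinElement c v) := by
      noncomm_ring
    rw [e, hc.spinElement_commutator hv, hc.spinElement_commutator hv, Finset.sum_mul,
      Finset.mul_sum, ← Finset.sum_add_distrib]
    simp
  have h2 : spinElement c v * spinElement c w - spinElement c w * spinElement c v =
      (1 / 4 : ℂ) • ∑ k, ∑ l, w k l •
        (spinElement c v * (c k * c l) - c k * c l * spinElement c v) := by
    conv_lhs => rw [spinElement.eq_def c w]
    simp only [smul_mul_assoc, mul_smul_comm, Finset.sum_mul, Finset.mul_sum,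
      ← smul_sub, ← Finset.sum_sub_distrib]
  simp only [h1] at h2
  rw [h2, spinElement]
  congr 1
  simp only [Finset.smul_sum, Finset.sum_smul, smul_add, Finset.sum_add_distrib, smul_smul,
    sub_smul, Finset.sum_sub_distrib]
  rw [sub_eq_add_neg, ← Finset.sum_neg_distrib]
  congr 1
  · calc ∑ k, ∑ l, ∑ m, (w k l * v k m) • (c m * c l)
        = ∑ l, ∑ k, ∑ m, (w k l * v k m) • (c m * c l) := Finset.sum_comm
      _ = ∑ l, ∑ m, ∑ k, (w k l * v k m) • (c m * c l) :=
        Finset.sum_congr rfl fun l _ => Finset.sum_comm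
      _ = ∑ m, ∑ l, ∑ k, (w k l * v k m) • (c m * c l) := Finset.sum_comm
      _ = _ := by
        refine Finset.sum_congr rfl fun k _ => Finset.sum_congr rfl fun l _ =>
          Finset.sum_congr rfl fun m _ => ?_
        rw [hw m l, hv m k]
        module
  · refine Finset.sum_congr rfl fun k _ => ?_
    rw [Finset.sum_comm, ← Finset.sum_neg_distrib]
    refine Finset.sum_congr rfl fun l _ => ?_
    rw [← Finset.sum_neg_distrib]
    refine Finset.sum_congr rfl fun m _ => ?_
    rw [hv m l]
    module

/-- The contraction of an algebraic curvature tensor with Clifford multiplication is scalar. -/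
theorem CliffordRelations.curvature_contraction (hc : CliffordRelations c) {R : ι → ι → ι → ι → ℂ}
    (h1 : ∀ i j k l, R i j k l = -R j i k l) (h2 : ∀ i j k l, R i j k l = -R i j l k)
    (h3 : ∀ i j k l, R i j k l + R j k i l + R k i j l = 0) :
    ∑ i, ∑ j, ∑ k, ∑ l, R i j k l • (c i * c j * (c k * c l)) =
      ((2 : ℂ) * ∑ i, ∑ j, R i j j i) • (1 : A) := by
  -- Pair symmetry, from four Bianchi identities and the two antisymmetries.
  have pair (i j k l : ι) : R i j k l = R k l i j := by
    linear_combination (1 / 2) * (h3 i j k l + h3 j k l i - h3 k l i j - h3 l i j k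
      - h2 j k l i - h2 k l j i - h1 l j k i + h1 l i k j - h2 i l k j + h1 i k l j - h2 k i l j
      + h1 l i j k + h2 i j l k + h2 j l i k)
  have diag (i k l : ι) : R i i k l = 0 := by linear_combination (1 / 2) * h1 i i k l
  -- Cyclic rotations of c_i c_j c_k agree up to terms of degree one.
  have cyc1 (i j k : ι) : c j * c k * c i = c i * c j * c k - (if i = j then (-2 : ℂ) else 0) • c k
      + (if i = k then (-2 : ℂ) else 0) • c j := by
    rw [mul_assoc, eq_sub_of_add_eq' (hc i k), hc.swap i j]
    rw [mul_sub, ← mul_assoc]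
    simp only [sub_mul, mul_smul_comm, smul_mul_assoc, mul_one, one_mul]
    abel
  have cyc2 (i j k : ι) : c k * c i * c j = c i * c j * c k + (if i = k then (-2 : ℂ) else 0) • c j
      - (if j = k then (-2 : ℂ) else 0) • c i := by
    rw [eq_sub_of_add_eq' (hc i k), mul_assoc (c i), hc.swap j k, mul_sub, ← mul_assoc, sub_mul]
    simp only [mul_smul_comm, smul_mul_assoc, mul_one, one_mul, mul_assoc]
    abel
  -- Relabelling makes the three cyclically rotated sums equal, so three times the sum is their
  -- total. In the total, the cubic part is killed by the Bianchi identity and only contractions of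
  -- R survive.
  have three (l : ι) : ∑ i, ∑ j, ∑ k, R i j k l • (c i * c j * c k) =
      (2 : ℂ) • ∑ k, ∑ i, R i k i l • c k := by
    have e1 : ∑ i, ∑ j, ∑ k, R j k i l • (c j * c k * c i) =
        ∑ i, ∑ j, ∑ k, R i j k l • (c i * c j * c k) := by
      rw [Finset.sum_comm]
      exact Finset.sum_congr rfl fun _ _ => Finset.sum_comm
    have e2 : ∑ i, ∑ j, ∑ k, R k i j l • (c k * c i * c j) =
        ∑ i, ∑ j, ∑ k, R i j k l • (c i * c j * c k) := by
      rw [Finset.sum_congr rfl fun _ _ => Finset.sum_comm]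
      exact Finset.sum_comm
    have e3 (i j k : ι) : R i j k l • (c i * c j * c k) + R j k i l • (c j * c k * c i)
        + R k i j l • (c k * c i * c j) = (if i = j then (2 : ℂ) • R j k i l • c k else 0)
          + (if i = k then (2 : ℂ) • R k j i l • c j else 0)
          + (if j = k then (2 : ℂ) • R k i j l • c i else 0) := by
      have e : R i j k l = -R j k i l - R k i j l := by linear_combination h3 i j k l
      have q (P : Prop) [Decidable P] (a : A) : (if P then (2 : ℂ) • a else 0) =
          -((if P then (-2 : ℂ) else 0) • a) := by
        split_ifs <;> simp
      -- The rotations also produce this contraction, which vanishes because its first two indices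
      -- coincide.
      have d : (if i = k then (-2 : ℂ) else 0) • R k i j l • c j = 0 := by
        split_ifs with h
        · rw [h, diag]
          simp
        · simp
      rw [cyc1 i j k, cyc2 i j k, e, h1 k j i l, q, q, q]
      rw [← sub_eq_zero]
      refine Eq.trans ?_ d
      module
    have e4 : (3 : ℂ) • ∑ i, ∑ j, ∑ k, R i j k l • (c i * c j * c k) =
        (3 : ℂ) • (2 : ℂ) • ∑ k, ∑ i, R i k i l • c k := by
      calc (3 : ℂ) • ∑ i, ∑ j, ∑ k, R i j k l • (c i * c j * c k)
          = ∑ i, ∑ j, ∑ k, R i j k l • (c i * c j * c k)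
            + ∑ i, ∑ j, ∑ k, R j k i l • (c j * c k * c i)
            + ∑ i, ∑ j, ∑ k, R k i j l • (c k * c i * c j) := by
            rw [e1, e2]
            module
        _ = ∑ i, ∑ k, (2 : ℂ) • R i k i l • c k + ∑ i, ∑ j, (2 : ℂ) • R i j i l • c j
            + ∑ i, ∑ j, (2 : ℂ) • R j i j l • c i := by
            simp only [← Finset.sum_add_distrib, e3]
            simp only [Finset.sum_add_distrib, Finset.sum_ite_eq, Finset.mem_univ, if_true]
            congr 2
            refine Finset.sum_congr rfl fun i _ => ?_
            rw [Finset.sum_comm]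
            simp
        _ = _ := by
            rw [Finset.sum_comm]
            simp only [← Finset.smul_sum]
            module
    exact smul_right_injective A (three_ne_zero' ℂ) e4
  -- The Ricci contraction is symmetric by pair symmetry, so only the anticommutator of c_k and c_l
  -- matters, and it is scalar.
  have sym : (2 : ℂ) • ∑ k, ∑ l, ∑ i, R i k i l • (c k * c l) =
      (2 : ℂ) • ∑ i, ∑ k, R i k k i • (1 : A) := by
    calc (2 : ℂ) • ∑ k, ∑ l, ∑ i, R i k i l • (c k * c l)
        = ∑ k, ∑ l, ∑ i, R i k i l • (c k * c l) + ∑ k, ∑ l, ∑ i, R i l i k • (c l * c k) := by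
          rw [two_smul, Finset.sum_comm (f := fun k l => ∑ i, R i l i k • (c l * c k))]
      _ = ∑ k, ∑ l, ∑ i, if k = l then (2 : ℂ) • R i k k i • (1 : A) else 0 := by
          simp only [← Finset.sum_add_distrib]
          refine Finset.sum_congr rfl fun k _ => Finset.sum_congr rfl fun l _ =>
            Finset.sum_congr rfl fun i _ => ?_
          rw [pair i l i k, ← smul_add, hc k l]
          split_ifs with h
          · rw [h, h2 i l i l]
            module
          · simp
      _ = _ := by
          simp only [Finset.smul_sum]
          rw [Finset.sum_comm (f := fun i k => (2 : ℂ) • R i k k i • (1 : A))]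
          refine Finset.sum_congr rfl fun k _ => ?_
          rw [Finset.sum_comm]
          simp
  calc ∑ i, ∑ j, ∑ k, ∑ l, R i j k l • (c i * c j * (c k * c l))
      = ∑ l, (∑ i, ∑ j, ∑ k, R i j k l • (c i * c j * c k)) * c l := by
        simp only [Finset.sum_mul, smul_mul_assoc, mul_assoc]
        symm
        rw [Finset.sum_comm]
        refine Finset.sum_congr rfl fun i _ => ?_
        rw [Finset.sum_comm]
        refine Finset.sum_congr rfl fun j _ => ?_
        rw [Finset.sum_comm]
    _ = (2 : ℂ) • ∑ k, ∑ l, ∑ i, R i k i l • (c k * c l) := by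
        simp only [three, Finset.sum_mul, smul_mul_assoc, ← Finset.smul_sum]
        rw [Finset.sum_comm]
    _ = _ := by
        rw [sym]
        simp only [mul_smul, Finset.sum_smul]

end CliffordRelations

/-- Expanding b in e leaves Σ_i ⟨e_k, b_i⟩⟨b_i, e_l⟩ = δ_kl. Two index types are needed since
`stdOrthonormalBasis` is indexed by the `finrank`, not by `Fin n`. -/
theorem sum_bilinear_orthonormalBasis {V : Type*} [NormedAddCommGroup V] [InnerProductSpace ℝ V]
    {ι ι' : Type*} [Fintype ι] [Fintype ι'] (b : OrthonormalBasis ι ℝ V)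
    (e : OrthonormalBasis ι' ℝ V) (B : V →ₗ[ℝ] V →ₗ[ℝ] ℝ) :
    ∑ i, B (b i) (b i) = ∑ k, B (e k) (e k) := by
  classical
  have h1 (i : ι) : B (b i) (b i) =
      ∑ k, ∑ l, (inner ℝ (e k) (b i) * inner ℝ (b i) (e l)) * B (e k) (e l) := by
    conv_lhs => rw [← e.sum_repr' (b i)]
    simp only [map_sum, map_smul, LinearMap.sum_apply, LinearMap.smul_apply, smul_eq_mul,
      Finset.mul_sum]
    rw [Finset.sum_comm]
    refine Finset.sum_congr rfl fun k _ => Finset.sum_congr rfl fun l _ => ?_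
    rw [real_inner_comm (b i) (e l)]
    ring
  simp only [h1]
  rw [Finset.sum_comm]
  refine Finset.sum_congr rfl fun k _ => ?_
  rw [Finset.sum_comm]
  simp only [← Finset.sum_mul, b.sum_inner_mul_inner, e.inner_eq_ite]
  simp

/-! ### Levi-Civita connection: Bianchi identity, orthonormal frames, Laplacian. -/

section Riemannian

variable {n : ℕ} {M : Type*} [TopologicalSpace M] [T2Space M]
  [ChartedSpace (EuclideanSpace ℝ (Fin n)) M] [IsManifold (𝓡 n) ∞ M]
  [RiemannianBundle (fun x : M => TangentSpace (𝓡 n) x)]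
  [IsContMDiffRiemannianBundle (𝓡 n) ∞ (EuclideanSpace ℝ (Fin n))
    (fun x : M => TangentSpace (𝓡 n) x)]
  {D : AffineConnection n M}

theorem inner_gradient (f : M → ℝ) {x : M} (v : TangentSpace (𝓡 n) x) :
    inner ℝ (gradient f x) v = mvfderiv (𝓡 n) f x v := by
  conv_rhs => rw [← (stdOrthonormalBasis ℝ (TangentSpace (𝓡 n) x)).sum_repr' v]
  simp [gradient, sum_inner, inner_smul_left, mul_comm]

theorem IsLeviCivita.mvfderiv_inner (hD : IsLeviCivita D) {x : M}
    {X Y : Π y : M, TangentSpace (𝓡 n) y}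
    (hX : DiffAt n (EuclideanSpace ℝ (Fin n)) X x) (hY : DiffAt n (EuclideanSpace ℝ (Fin n)) Y x)
    (v : TangentSpace (𝓡 n) x) :
    mvfderiv (𝓡 n) (fun y => inner ℝ (X y) (Y y)) x v =
      inner ℝ (D X x v) (Y x) + inner ℝ (X x) (D Y x v) := by
  have h := hD.metric.mvfderiv_inner_eq (FiberBundle.extend (EuclideanSpace ℝ (Fin n)) v) hX hY
  simpa using h

theorem IsLeviCivita.sub_eq_mlieBracket (hD : IsLeviCivita D) {x : M}
    {X Y : Π y : M, TangentSpace (𝓡 n) y}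
    (hX : DiffAt n (EuclideanSpace ℝ (Fin n)) X x)
    (hY : DiffAt n (EuclideanSpace ℝ (Fin n)) Y x) :
    D Y x (X x) - D X x (Y x) = VectorField.mlieBracket (𝓡 n) X Y x :=
  D.torsion_eq_zero_iff.1 hD.torsion_free hX hY

/-- Vanishing torsion turns ∇_X(∇_Y Z - ∇_Z Y) - ∇_{[Y,Z]} X into [X, [Y, Z]]. The cyclic sum of
curvatures is the cyclic sum of these, which is zero by Jacobi. -/
theorem IsLeviCivita.bianchi (hD : IsLeviCivita D) {x : M}
    {X Y Z : Π y : M, TangentSpace (𝓡 n) y}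
    (hX : SmoothNear n (EuclideanSpace ℝ (Fin n)) X x)
    (hY : SmoothNear n (EuclideanSpace ℝ (Fin n)) Y x)
    (hZ : SmoothNear n (EuclideanSpace ℝ (Fin n)) Z x) :
    curvatureField D X Y Z x + curvatureField D Y Z X x + curvatureField D Z X Y x = 0 := by
  have key {X Y Z : Π y : M, TangentSpace (𝓡 n) y}
      (hX : SmoothNear n (EuclideanSpace ℝ (Fin n)) X x)
      (hY : SmoothNear n (EuclideanSpace ℝ (Fin n)) Y x)
      (hZ : SmoothNear n (EuclideanSpace ℝ (Fin n)) Z x) :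
      D (fun y => D Z y (Y y)) x (X x) - D (fun y => D Y y (Z y)) x (X x)
        - D X x (VectorField.mlieBracket (𝓡 n) Y Z x) =
      VectorField.mlieBracket (𝓡 n) X (VectorField.mlieBracket (𝓡 n) Y Z) x := by
    have hb := (hY.mlieBracket hZ).diffAt
    have h1 := hY.diffAt_covariantDerivative hD.smooth hZ.diffAt
    have h2 := hZ.diffAt_covariantDerivative hD.smooth hY.diffAt
    have h3 : ∀ᶠ y in 𝓝 x, D Z y (Y y) =
        ((fun y => D Y y (Z y)) + VectorField.mlieBracket (𝓡 n) Y Z) y := by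
      filter_upwards [hY.eventually, hZ.eventually] with y h1 h2
      rw [Pi.add_apply, ← hD.sub_eq_mlieBracket h1.diffAt h2.diffAt]
      abel
    rw [D.isCovariantDerivativeOnUniv.congr_of_eventuallyEq h2
        (mdifferentiableAt_add_section h1 hb) Filter.univ_mem h3,
      D.isCovariantDerivativeOnUniv.add h1 hb, ← hD.sub_eq_mlieBracket hX.diffAt hb]
    simp
  have hJ := jacobi_mlieBracket hX hY hZ
  have hs : VectorField.mlieBracket (𝓡 n) Y (VectorField.mlieBracket (𝓡 n) X Z) x =
      -VectorField.mlieBracket (𝓡 n) Y (VectorField.mlieBracket (𝓡 n) Z X) x := by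
    rw [VectorField.mlieBracket_swap (V := X) (W := Z),
      show -VectorField.mlieBracket (𝓡 n) Z X = (-1 : ℝ) • VectorField.mlieBracket (𝓡 n) Z X by simp,
      VectorField.mlieBracket_const_smul_right (hZ.mlieBracket hX).diffAt]
    simp
  rw [hs, VectorField.mlieBracket_swap_apply (V := VectorField.mlieBracket (𝓡 n) X Y),
    ← key hX hY hZ, ← key hY hZ hX, ← key hZ hX hY] at hJ
  simp only [curvatureField]
  rw [← sub_eq_zero] at hJ
  rw [← hJ]
  abel

/-! The curvature tensor at a point is trilinear. -/

theorem curvature_add_right (hD : IsLeviCivita D) {x : M} (v w u u' : TangentSpace (𝓡 n) x) :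
    curvature D v w (u + u') = curvature D v w u + curvature D v w u' := by
  have hv := smoothNear_extend (n := n) (F := EuclideanSpace ℝ (Fin n)) v
  have hw := smoothNear_extend (n := n) (F := EuclideanSpace ℝ (Fin n)) w
  have hu := smoothNear_extend (n := n) (F := EuclideanSpace ℝ (Fin n)) u
  have hu' := smoothNear_extend (n := n) (F := EuclideanSpace ℝ (Fin n)) u'
  have h := curvatureField_add hD.smooth hu hu' hv.diffAt hw.diffAt
  rw [curvatureField_eq_curvature hD.smooth (hu.add hu') hv hw] at h
  simpa [curvature] using h

theorem curvature_smul_right (hD : IsLeviCivita D) {x : M} (v w u : TangentSpace (𝓡 n) x)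
    (r : ℝ) : curvature D v w (r • u) = r • curvature D v w u := by
  have hv := smoothNear_extend (n := n) (F := EuclideanSpace ℝ (Fin n)) v
  have hw := smoothNear_extend (n := n) (F := EuclideanSpace ℝ (Fin n)) w
  have hu := smoothNear_extend (n := n) (F := EuclideanSpace ℝ (Fin n)) u
  have hr : FunSmoothNear (n := n) (fun _ : M => r) x := ⟨_, Filter.univ_mem, contMDiffOn_const⟩
  have h := curvatureField_smul_section hD.smooth hu hr hv hw
  rw [curvatureField_eq_curvature hD.smooth (SmoothNear.smul hr hu) hv hw] at h
  simpa [curvature] using h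

theorem curvature_add_left (hD : IsLeviCivita D) {x : M} (v v' w u : TangentSpace (𝓡 n) x) :
    curvature D (v + v') w u = curvature D v w u + curvature D v' w u :=
  (TensorialAt.mkHom _ x (tensorialAt_curvatureField hD.smooth
    (smoothNear_extend (n := n) (F := EuclideanSpace ℝ (Fin n)) u)
    (FiberBundle.extend (EuclideanSpace ℝ (Fin n)) w))).map_add v v'

theorem curvature_smul_left (hD : IsLeviCivita D) {x : M} (v w u : TangentSpace (𝓡 n) x)
    (r : ℝ) : curvature D (r • v) w u = r • curvature D v w u :=
  (TensorialAt.mkHom _ x (tensorialAt_curvatureField hD.smooth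
    (smoothNear_extend (n := n) (F := EuclideanSpace ℝ (Fin n)) u)
    (FiberBundle.extend (EuclideanSpace ℝ (Fin n)) w))).map_smul r v

theorem curvature_antisymm {x : M} (v w u : TangentSpace (𝓡 n) x) :
    curvature D v w u = -curvature D w v u :=
  curvatureField_antisymm _ _ _ _

/-- The double trace is changed to the new basis one index at a time, the other being fixed.
Linearity in the second slot of the curvature comes from the first by antisymmetry. -/
theorem scalarCurvature_eq_sum (hD : IsLeviCivita D) {x : M}
    (e : OrthonormalBasis (Fin n) ℝ (TangentSpace (𝓡 n) x)) :
    scalarCurvature D x = ∑ i, ∑ j, inner ℝ (curvature D (e i) (e j) (e j)) (e i) := by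
  have inv1 (v : TangentSpace (𝓡 n) x) {ι ι' : Type} [Fintype ι] [Fintype ι']
      (b : OrthonormalBasis ι ℝ (TangentSpace (𝓡 n) x))
      (e : OrthonormalBasis ι' ℝ (TangentSpace (𝓡 n) x)) :
      ∑ j, inner ℝ (curvature D v (b j) (b j)) v = ∑ j, inner ℝ (curvature D v (e j) (e j)) v :=
    sum_bilinear_orthonormalBasis b e (LinearMap.mk₂ ℝ (fun w u => inner ℝ (curvature D v w u) v)
      (fun w w' u => by
        rw [curvature_antisymm, curvature_add_left hD, curvature_antisymm w v,
          curvature_antisymm w' v, ← inner_add_left]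
        congr 1
        abel)
      (fun r w u => by
        rw [curvature_antisymm, curvature_smul_left hD, curvature_antisymm w v, smul_neg, neg_neg,
          real_inner_smul_left, smul_eq_mul])
      (fun w u u' => by rw [curvature_add_right hD, inner_add_left])
      (fun r w u => by rw [curvature_smul_right hD, real_inner_smul_left, smul_eq_mul]))
  have inv2 (w : TangentSpace (𝓡 n) x) {ι ι' : Type} [Fintype ι] [Fintype ι']
      (b : OrthonormalBasis ι ℝ (TangentSpace (𝓡 n) x))
      (e : OrthonormalBasis ι' ℝ (TangentSpace (𝓡 n) x)) :
      ∑ i, inner ℝ (curvature D (b i) w w) (b i) = ∑ i, inner ℝ (curvature D (e i) w w) (e i) :=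
    sum_bilinear_orthonormalBasis b e (LinearMap.mk₂ ℝ (fun v u => inner ℝ (curvature D v w w) u)
      (fun v v' u => by rw [curvature_add_left hD, inner_add_left])
      (fun r v u => by rw [curvature_smul_left hD, real_inner_smul_left, smul_eq_mul])
      (fun v u u' => by rw [inner_add_right])
      (fun r v u => by rw [real_inner_smul_right, smul_eq_mul]))
  simp only [scalarCurvature]
  rw [Finset.sum_congr rfl fun i _ => inv1 _ _ e, Finset.sum_comm,
    Finset.sum_congr rfl fun j _ => inv2 _ _ e, Finset.sum_comm]

/-! ### Local orthonormal frames -/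

/-- A family of orthonormal bases of the tangent spaces, smooth near a point. -/
def SmoothFrameNear (e : Π y : M, OrthonormalBasis (Fin n) ℝ (TangentSpace (𝓡 n) y)) (x : M) :
    Prop :=
  ∀ i, SmoothNear n (EuclideanSpace ℝ (Fin n)) (fun y => e y i) x

/-- The connection form `⟨∇_v e_k, e_l⟩` of a frame. -/
def connectionForm (D : AffineConnection n M)
    (e : Π y : M, OrthonormalBasis (Fin n) ℝ (TangentSpace (𝓡 n) y)) {x : M}
    (v : TangentSpace (𝓡 n) x) (k l : Fin n) : ℝ :=
  inner ℝ (D (fun y => e y k) x v) (e x l)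

/-- The components `⟨R(e_i, e_j) e_k, e_l⟩` of the curvature tensor in a frame. -/
def curvatureComponent (D : AffineConnection n M)
    (e : Π y : M, OrthonormalBasis (Fin n) ℝ (TangentSpace (𝓡 n) y)) (x : M)
    (i j k l : Fin n) : ℝ :=
  inner ℝ (curvatureField D (fun y => e y i) (fun y => e y j) (fun y => e y k) x) (e x l)

variable {e : Π y : M, OrthonormalBasis (Fin n) ℝ (TangentSpace (𝓡 n) y)} {x : M}

theorem SmoothFrameNear.eventually (he : SmoothFrameNear e x) :
    ∀ᶠ y in 𝓝 x, SmoothFrameNear e y :=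
  Filter.eventually_all.2 fun i => (he i).eventually

/-- Differentiate ⟨e_k, e_l⟩ = δ_kl. -/
theorem connectionForm_antisymm (hD : IsLeviCivita D) (he : SmoothFrameNear e x)
    (v : TangentSpace (𝓡 n) x) (k l : Fin n) :
    connectionForm D e v k l = -connectionForm D e v l k := by
  have h := hD.mvfderiv_inner (he k).diffAt (he l).diffAt v
  have h' : (fun y => (inner ℝ (e y k) (e y l) : ℝ)) = fun _ => if k = l then 1 else 0 := by
    ext y
    rw [(e y).inner_eq_ite]
  rw [h', mvfderiv_const, real_inner_comm (D (fun y => e y l) x v), zero_apply] at h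
  rw [connectionForm, connectionForm]
  linarith

theorem covariantDerivative_eq_sum (v : TangentSpace (𝓡 n) x) (k : Fin n) :
    D (fun y => e y k) x v = ∑ l, connectionForm D e v k l • e x l := by
  conv_lhs => rw [← (e x).sum_repr' (D (fun y => e y k) x v)]
  simp only [connectionForm, real_inner_comm]

theorem diffAt_connectionForm (hD : IsLeviCivita D) (he : SmoothFrameNear e x)
    {Y : Π y : M, TangentSpace (𝓡 n) y} (hY : DiffAt n (EuclideanSpace ℝ (Fin n)) Y x)
    (k l : Fin n) : FunDiffAt (n := n) (fun y => connectionForm D e (Y y) k l) x :=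
  MDifferentiableAt.inner_bundle ((he k).diffAt_covariantDerivative hD.smooth hY) (he l).diffAt

/-- The structure equation for the curvature of the Levi-Civita connection. -/
theorem inner_curvatureField_eq (hD : IsLeviCivita D) (he : SmoothFrameNear e x)
    {X Y : Π y : M, TangentSpace (𝓡 n) y} (hX : DiffAt n (EuclideanSpace ℝ (Fin n)) X x)
    (hY : DiffAt n (EuclideanSpace ℝ (Fin n)) Y x) (k l : Fin n) :
    inner ℝ (curvatureField D X Y (fun y => e y k) x) (e x l) =
      mvfderiv (𝓡 n) (fun y => connectionForm D e (Y y) k l) x (X x)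
      - mvfderiv (𝓡 n) (fun y => connectionForm D e (X y) k l) x (Y x)
      - connectionForm D e (VectorField.mlieBracket (𝓡 n) X Y x) k l
      + ∑ m, (connectionForm D e (X x) k m * connectionForm D e (Y x) l m
        - connectionForm D e (Y x) k m * connectionForm D e (X x) l m) := by
  -- Metric compatibility applied to ω(Y)_kl = ⟨∇_Y e_k, e_l⟩; the extra term ⟨∇_Y e_k, ∇_X e_l⟩ is
  -- expanded in the frame.
  have key {X Y : Π y : M, TangentSpace (𝓡 n) y}
      (hY : DiffAt n (EuclideanSpace ℝ (Fin n)) Y x) :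
      inner ℝ (D (fun y => D (fun y => e y k) y (Y y)) x (X x)) (e x l) =
        mvfderiv (𝓡 n) (fun y => connectionForm D e (Y y) k l) x (X x)
        - ∑ m, connectionForm D e (Y x) k m * connectionForm D e (X x) l m := by
    have h := hD.mvfderiv_inner ((he k).diffAt_covariantDerivative hD.smooth hY) (he l).diffAt (X x)
    simp only [connectionForm] at h ⊢
    rw [h, ← (e x).sum_inner_mul_inner (D (fun y => e y k) x (Y x))]
    simp only [real_inner_comm (e x _) (D (fun y => e y l) x (X x))]
    ring
  rw [curvatureField, inner_sub_left, inner_sub_left, key hY, key hX, Finset.sum_sub_distrib]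
  simp only [connectionForm]
  ring

theorem curvatureComponent_antisymm_left (i j k l : Fin n) :
    curvatureComponent D e x i j k l = -curvatureComponent D e x j i k l := by
  rw [curvatureComponent, curvatureField_antisymm, inner_neg_left, curvatureComponent]

/-- Every term of the structure equation is antisymmetric in k and l, because ω is so in a whole
neighbourhood. -/
theorem curvatureComponent_antisymm_right (hD : IsLeviCivita D) (he : SmoothFrameNear e x)
    (i j k l : Fin n) :
    curvatureComponent D e x i j k l = -curvatureComponent D e x i j l k := by
  have h (i j : Fin n) : mvfderiv (𝓡 n) (fun y => connectionForm D e (e y i) k l) x (e x j) =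
      -mvfderiv (𝓡 n) (fun y => connectionForm D e (e y i) l k) x (e x j) := by
    rw [mvfderiv_congr_of_eventuallyEq (h := -fun y => connectionForm D e (e y i) l k)
      (he.eventually.mono fun y hy => connectionForm_antisymm hD hy _ k l), mvfderiv_neg]
    rfl
  rw [curvatureComponent, curvatureComponent, inner_curvatureField_eq hD he (he i).diffAt
    (he j).diffAt, inner_curvatureField_eq hD he (he i).diffAt (he j).diffAt, h, h,
    connectionForm_antisymm hD he _ k l, Finset.sum_sub_distrib, Finset.sum_sub_distrib]
  simp only [mul_comm (connectionForm D e _ l _)]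
  ring

theorem curvatureComponent_bianchi (hD : IsLeviCivita D) (he : SmoothFrameNear e x)
    (i j k l : Fin n) :
    curvatureComponent D e x i j k l + curvatureComponent D e x j k i l
      + curvatureComponent D e x k i j l = 0 := by
  rw [curvatureComponent, curvatureComponent, curvatureComponent, ← inner_add_left,
    ← inner_add_left, hD.bianchi (he i) (he j) (he k), inner_zero_left]

theorem scalarCurvature_eq_sum_component (hD : IsLeviCivita D) (he : SmoothFrameNear e x) :
    scalarCurvature D x = ∑ i, ∑ j, curvatureComponent D e x i j j i := by
  rw [scalarCurvature_eq_sum hD (e x)]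
  refine Finset.sum_congr rfl fun i _ => Finset.sum_congr rfl fun j _ => ?_
  rw [curvatureComponent, curvatureField_eq_curvature hD.smooth (he j) (he i) (he j)]

theorem gradient_eq_sum (f : M → ℝ) (b : OrthonormalBasis (Fin n) ℝ (TangentSpace (𝓡 n) x)) :
    gradient f x = ∑ i, mvfderiv (𝓡 n) f x (b i) • b i := by
  conv_lhs => rw [← b.sum_repr' (gradient f x)]
  simp only [real_inner_comm, inner_gradient]

theorem norm_gradient_sq (f : M → ℝ) (b : OrthonormalBasis (Fin n) ℝ (TangentSpace (𝓡 n) x)) :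
    ‖(gradient f x : TangentSpace (𝓡 n) x)‖ ^ 2 = ∑ i, mvfderiv (𝓡 n) f x (b i) ^ 2 := by
  rw [← b.sum_sq_norm_inner_right]
  simp only [real_inner_comm, inner_gradient, Real.norm_eq_abs, sq_abs]

theorem laplacian_eq_sum (hD : IsLeviCivita D) (he : SmoothFrameNear e x) {f : M → ℝ}
    (hf : FunSmoothNear (n := n) f x) :
    laplacian D f x = ∑ i, (mvfderiv (𝓡 n) (fun y => mvfderiv (𝓡 n) f y (e y i)) x (e x i)
      - mvfderiv (𝓡 n) f x (D (fun y => e y i) x (e x i))) := by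
  -- `gradient` is built from bases chosen separately at each point, so its regularity is read off
  -- from its expansion in the smooth frame.
  have hg : DiffAt n (EuclideanSpace ℝ (Fin n)) (gradient f) x :=
    ((SmoothNear.sum Finset.univ fun i => SmoothNear.smul (hf.mvfderiv (he i)) (he i)).congr
      (Filter.Eventually.of_forall fun y => gradient_eq_sum f (e y))).diffAt
  rw [laplacian, LinearMap.trace_eq_sum_inner _ (e x)]
  refine Finset.sum_congr rfl fun i _ => ?_
  have h := hD.mvfderiv_inner hg (he i).diffAt (e x i)
  simp only [inner_gradient] at h
  rw [h, real_inner_comm]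
  simp

end Riemannian

/-! ### Components of Σ_n ⊗ E in the standard basis of Σ_n. -/

section Components

variable {n : ℕ} {M : Type*} {E : M → Type*} [∀ x, AddCommGroup (E x)] [∀ x, Module ℂ (E x)]

/-- The action of endomorphisms of `Σ_n` on `Σ_n ⊗ E x`. -/
def spinorAction (x : M) : Module.End ℂ (Spinor n) →ₐ[ℂ] Module.End ℂ (Spinor n ⊗[ℂ] E x) :=
  Module.End.rTensorAlgHom ℂ (Spinor n) (E x)

theorem rTensor_eq_spinorAction {x : M} (B : Module.End ℂ (Spinor n)) :
    LinearMap.rTensor (E x) B = spinorAction (E := E) x B := rfl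

/-- `component` as a linear map. -/
def componentₗ (x : M) (a : Fin (2 ^ (n / 2))) : Spinor n ⊗[ℂ] E x →ₗ[ℂ] E x :=
  (TensorProduct.lid ℂ (E x)).toLinearMap ∘ₗ LinearMap.rTensor (E x) (LinearMap.proj a)

theorem component_eq {x : M} (a : Fin (2 ^ (n / 2))) (t : Spinor n ⊗[ℂ] E x) :
    component a t = componentₗ x a t := rfl

theorem component_tmul {x : M} (a : Fin (2 ^ (n / 2))) (ψ : Spinor n) (u : E x) :
    component a (ψ ⊗ₜ[ℂ] u) = ψ a • u := by
  simp [component]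

theorem component_add {x : M} (a : Fin (2 ^ (n / 2))) (t t' : Spinor n ⊗[ℂ] E x) :
    component a (t + t') = component a t + component a t' := map_add (componentₗ x a) t t'

theorem component_sub {x : M} (a : Fin (2 ^ (n / 2))) (t t' : Spinor n ⊗[ℂ] E x) :
    component a (t - t') = component a t - component a t' := map_sub (componentₗ x a) t t'

theorem component_smul {x : M} (a : Fin (2 ^ (n / 2))) (z : ℂ) (t : Spinor n ⊗[ℂ] E x) :
    component a (z • t) = z • component a t := map_smul (componentₗ x a) z t

theorem component_sum {x : M} (a : Fin (2 ^ (n / 2))) {ι : Type*} (I : Finset ι)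
    (t : ι → Spinor n ⊗[ℂ] E x) : component a (∑ i ∈ I, t i) = ∑ i ∈ I, component a (t i) :=
  map_sum (componentₗ x a) t I

theorem component_sum_single {x : M} (a : Fin (2 ^ (n / 2))) (u : Fin (2 ^ (n / 2)) → E x) :
    component a (∑ b, (Pi.single b 1 : Spinor n) ⊗ₜ[ℂ] u b) = u a := by
  simp [component_sum, component_tmul, Pi.single_apply]

theorem sum_single_component {x : M} (t : Spinor n ⊗[ℂ] E x) :
    ∑ a, (Pi.single a 1 : Spinor n) ⊗ₜ[ℂ] component a t = t := by
  induction t with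
  | zero => simp [component_eq]
  | tmul ψ u =>
    simp only [component_tmul, TensorProduct.tmul_smul, TensorProduct.smul_tmul', ←
      TensorProduct.sum_tmul]
    congr 1
    ext a
    simp [Pi.single_apply]
  | add t t' h h' =>
    simp only [component_add, TensorProduct.tmul_add, Finset.sum_add_distrib, h, h']

theorem ext_component {x : M} {t t' : Spinor n ⊗[ℂ] E x}
    (h : ∀ a, component a t = component a t') : t = t' := by
  rw [← sum_single_component t, ← sum_single_component t']
  simp only [h]

theorem component_spinorAction {x : M} (B : Module.End ℂ (Spinor n)) (a : Fin (2 ^ (n / 2)))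
    (t : Spinor n ⊗[ℂ] E x) :
    component a (spinorAction x B t) = ∑ b, B (Pi.single b 1) a • component b t := by
  conv_lhs => rw [← sum_single_component t]
  rw [map_sum, component_sum]
  refine Finset.sum_congr rfl fun b _ => ?_
  rw [← rTensor_eq_spinorAction, LinearMap.rTensor_tmul, component_tmul]

theorem component_lTensor {x : M} (R : Module.End ℂ (E x)) (a : Fin (2 ^ (n / 2)))
    (t : Spinor n ⊗[ℂ] E x) :
    component a (LinearMap.lTensor (Spinor n) R t) = R (component a t) := by
  induction t with
  | zero => simp [component_eq]
  | tmul ψ u => simp [component_tmul]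
  | add t t' h h' => simp only [map_add, component_add, h, h']

end Components

/-! ### Trivial connection on Σ_n tensored with the connection of E. -/

section FlatConnection

variable {n : ℕ} {M : Type*} [TopologicalSpace M] [T2Space M]
  [ChartedSpace (EuclideanSpace ℝ (Fin n)) M] [IsManifold (𝓡 n) ∞ M]
  {F : Type*} [NormedAddCommGroup F] [NormedSpace ℂ F] [FiniteDimensional ℂ F]
  {E : M → Type*} [TopologicalSpace (TotalSpace F E)]
  [∀ x, AddCommGroup (E x)] [∀ x, Module ℂ (E x)] [∀ x, TopologicalSpace (E x)]
  [∀ x, IsTopologicalAddGroup (E x)] [∀ x, ContinuousSMul ℝ (E x)]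
  [FiberBundle F E] [VectorBundle ℂ F E] [VectorBundle ℝ F E]
  [ContMDiffVectorBundle ∞ F E (𝓡 n)]
  {DE : CovariantDerivative (𝓡 n) F E}

/-- Differentiability is over ℝ, whereas the scalar is complex; the trivialisation is ℂ-linear, so
the claim can be checked in the model fibre. -/
theorem DiffAt.complex_smul {s : Π y, E y} {x : M} (hs : DiffAt n F s x) (z : ℂ) :
    DiffAt n F (fun y => z • s y) x := by
  have h := (mdifferentiableAt_section (𝓡 n) s).1 hs
  refine (mdifferentiableAt_section (𝓡 n) _).2 ?_
  have hd : MDifferentiableAt 𝓘(ℝ, F) 𝓘(ℝ, F) (fun w : F => z • w)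
      (trivializationAt F E x ⟨x, s x⟩).2 :=
    (differentiableAt_id.const_smul z).mdifferentiableAt
  refine (hd.comp x h).congr_of_eventuallyEq ?_
  filter_upwards [(trivializationAt F E x).open_baseSet.mem_nhds
    (FiberBundle.mem_baseSet_trivializationAt' x)] with y hy
  exact ((trivializationAt F E x).linear ℂ hy).map_smul z (s y)

theorem DiffAt.add {s t : Π y, E y} {x : M} (hs : DiffAt n F s x) (ht : DiffAt n F t x) :
    DiffAt n F (fun y => s y + t y) x :=
  mdifferentiableAt_add_section hs ht

theorem DiffAt.sum {ι : Type*} (I : Finset ι) {s : ι → Π y, E y} {x : M}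
    (hs : ∀ i, DiffAt n F (s i) x) : DiffAt n F (fun y => ∑ i ∈ I, s i y) x :=
  MDifferentiableAt.sum_section fun i _ => hs i

/-- The real structure of the fibres is the restriction of the complex one, so a real scalar cast to
ℂ acts by definition as the real scalar. -/
theorem DiffAt.real_smul {s : Π y, E y} {x : M} (hs : DiffAt n F s x) {g : M → ℝ}
    (hg : FunDiffAt (n := n) g x) : DiffAt n F (fun y => (g y : ℂ) • s y) x :=
  MDifferentiableAt.smul_section hg hs

theorem covariantDerivative_add {s t : Π y, E y} {x : M} (hs : DiffAt n F s x)
    (ht : DiffAt n F t x) : DE (fun y => s y + t y) x = DE s x + DE t x :=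
  DE.isCovariantDerivativeOnUniv.add hs ht

theorem covariantDerivative_sum {ι : Type*} (I : Finset ι) {s : ι → Π y, E y} {x : M}
    (hs : ∀ i, DiffAt n F (s i) x) :
    DE (fun y => ∑ i ∈ I, s i y) x = ∑ i ∈ I, DE (s i) x := by
  classical
  induction I using Finset.induction_on with
  | empty =>
    simp only [Finset.sum_empty]
    exact DE.isCovariantDerivativeOnUniv.zero
  | insert a I ha ih =>
    simp only [Finset.sum_insert ha]
    rw [covariantDerivative_add (hs a) (DiffAt.sum I hs), ih]

/-- A section of the bundle `Σ_n ⊗ E` is differentiable at a point. -/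
def TwistedDiffAt (F : Type*) [NormedAddCommGroup F] [NormedSpace ℂ F]
    [TopologicalSpace (TotalSpace F E)] [FiberBundle F E]
    (s : Π y : M, Spinor n ⊗[ℂ] E y) (x : M) : Prop :=
  ∀ a, DiffAt n F (fun y => component a (s y)) x

/-- A section of the bundle `Σ_n ⊗ E` is smooth near a point. -/
def TwistedSmoothNear (F : Type*) [NormedAddCommGroup F] [NormedSpace ℂ F]
    [TopologicalSpace (TotalSpace F E)] [FiberBundle F E]
    (s : Π y : M, Spinor n ⊗[ℂ] E y) (x : M) : Prop :=
  ∀ a, SmoothNear n F (fun y => component a (s y)) x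

/-- The tensor product connection of the trivial connection on `Σ_n` and a connection on `E`. -/
def flatConnection (DE : CovariantDerivative (𝓡 n) F E) (s : Π y : M, Spinor n ⊗[ℂ] E y) (x : M)
    (v : TangentSpace (𝓡 n) x) : Spinor n ⊗[ℂ] E x :=
  ∑ a, (Pi.single a 1 : Spinor n) ⊗ₜ[ℂ] DE (fun y => component a (s y)) x v

variable {s t : Π y : M, Spinor n ⊗[ℂ] E y} {x : M}

theorem TwistedSmoothNear.diffAt (hs : TwistedSmoothNear F s x) : TwistedDiffAt F s x :=
  fun a => (hs a).diffAt

theorem TwistedSmoothNear.eventually (hs : TwistedSmoothNear F s x) :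
    ∀ᶠ y in 𝓝 x, TwistedSmoothNear F s y :=
  Filter.eventually_all.2 fun a => (hs a).eventually

theorem TwistedSmoothNear.real_smul (hs : TwistedSmoothNear F s x) {g : M → ℝ}
    (hg : FunSmoothNear (n := n) g x) : TwistedSmoothNear F (fun y => (g y : ℂ) • s y) x := by
  intro a
  simp only [component_smul]
  exact SmoothNear.smul hg (hs a)

theorem TwistedDiffAt.congr (hs : TwistedDiffAt F s x) (h : ∀ᶠ y in 𝓝 x, t y = s y) :
    TwistedDiffAt F t x :=
  fun a => (hs a).congr (h.mono fun y hy => by rw [hy])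

theorem TwistedDiffAt.add (hs : TwistedDiffAt F s x) (ht : TwistedDiffAt F t x) :
    TwistedDiffAt F (fun y => s y + t y) x := by
  intro a
  simp only [component_add]
  exact (hs a).add (ht a)

theorem TwistedDiffAt.sum {ι : Type*} (I : Finset ι) {s : ι → Π y : M, Spinor n ⊗[ℂ] E y}
    (hs : ∀ i, TwistedDiffAt F (s i) x) : TwistedDiffAt F (fun y => ∑ i ∈ I, s i y) x := by
  intro a
  simp only [component_sum]
  exact DiffAt.sum I fun i => hs i a

theorem TwistedDiffAt.real_smul (hs : TwistedDiffAt F s x) {g : M → ℝ}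
    (hg : FunDiffAt (n := n) g x) : TwistedDiffAt F (fun y => (g y : ℂ) • s y) x := by
  intro a
  simp only [component_smul]
  exact (hs a).real_smul hg

theorem TwistedDiffAt.spinorAction (hs : TwistedDiffAt F s x) (B : Module.End ℂ (Spinor n)) :
    TwistedDiffAt F (fun y => spinorAction y B (s y)) x := by
  intro a
  simp only [component_spinorAction]
  exact DiffAt.sum _ fun b => (hs b).complex_smul _

theorem component_flatConnection (v : TangentSpace (𝓡 n) x) (a : Fin (2 ^ (n / 2))) :
    component a (flatConnection DE s x v) = DE (fun y => component a (s y)) x v :=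
  component_sum_single a _

theorem TwistedSmoothNear.diffAt_flatConnection (hDE : IsComplexConnection DE)
    (hs : TwistedSmoothNear F s x) {Y : Π y : M, TangentSpace (𝓡 n) y}
    (hY : DiffAt n (EuclideanSpace ℝ (Fin n)) Y x) :
    TwistedDiffAt F (fun y => flatConnection DE s y (Y y)) x := by
  intro a
  simp only [component_flatConnection]
  exact (hs a).diffAt_covariantDerivative hDE.smooth hY

theorem flatConnection_congr (hs : TwistedDiffAt F s x) (ht : TwistedDiffAt F t x)
    (h : ∀ᶠ y in 𝓝 x, s y = t y) (v : TangentSpace (𝓡 n) x) :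
    flatConnection DE s x v = flatConnection DE t x v := by
  refine ext_component fun a => ?_
  rw [component_flatConnection, component_flatConnection,
    DE.isCovariantDerivativeOnUniv.congr_of_eventuallyEq (hs a) (ht a) Filter.univ_mem
      (h.mono fun y hy => by rw [hy])]

theorem flatConnection_add (hs : TwistedDiffAt F s x) (ht : TwistedDiffAt F t x)
    (v : TangentSpace (𝓡 n) x) :
    flatConnection DE (fun y => s y + t y) x v =
      flatConnection DE s x v + flatConnection DE t x v := by
  refine ext_component fun a => ?_
  simp only [component_flatConnection, component_add]
  rw [covariantDerivative_add (hs a) (ht a), add_apply]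

theorem flatConnection_sum {ι : Type*} (I : Finset ι) {s : ι → Π y : M, Spinor n ⊗[ℂ] E y}
    (hs : ∀ i, TwistedDiffAt F (s i) x) (v : TangentSpace (𝓡 n) x) :
    flatConnection DE (fun y => ∑ i ∈ I, s i y) x v = ∑ i ∈ I, flatConnection DE (s i) x v := by
  refine ext_component fun a => ?_
  simp only [component_flatConnection, component_sum]
  rw [covariantDerivative_sum I fun i => hs i a]
  simp

theorem flatConnection_real_smul (hs : TwistedDiffAt F s x) {g : M → ℝ}
    (hg : FunDiffAt (n := n) g x) (v : TangentSpace (𝓡 n) x) :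
    flatConnection DE (fun y => (g y : ℂ) • s y) x v =
      (g x : ℂ) • flatConnection DE s x v + (mvfderiv (𝓡 n) g x v : ℂ) • s x := by
  refine ext_component fun a => ?_
  simp only [component_flatConnection, component_smul, component_add]
  have h := DE.isCovariantDerivativeOnUniv.leibniz (hs a) hg
  exact congrArg (fun L => L v) h

/-- A constant matrix acts on components by complex combinations, so complex linearity of the
connection on E lets it pass through. -/
theorem flatConnection_spinorAction (hDE : IsComplexConnection DE) (hs : TwistedDiffAt F s x)
    (B : Module.End ℂ (Spinor n)) (v : TangentSpace (𝓡 n) x) :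
    flatConnection DE (fun y => spinorAction y B (s y)) x v =
      spinorAction x B (flatConnection DE s x v) := by
  refine ext_component fun a => ?_
  simp only [component_flatConnection, component_spinorAction]
  rw [covariantDerivative_sum _ fun b => (hs b).complex_smul _]
  simp only [sum_apply, hDE.complex_linear _ (hs _)]

theorem flatConnection_add_vector (v w : TangentSpace (𝓡 n) x) :
    flatConnection DE s x (v + w) = flatConnection DE s x v + flatConnection DE s x w := by
  simp only [flatConnection, map_add, TensorProduct.tmul_add, Finset.sum_add_distrib]

theorem flatConnection_smul_vector (r : ℝ) (v : TangentSpace (𝓡 n) x) :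
    flatConnection DE s x (r • v) = (r : ℂ) • flatConnection DE s x v := by
  refine ext_component fun a => ?_
  simp only [component_flatConnection, component_smul, map_smul]
  rfl

/-- The curvature of the tensor product of the trivial connection with a connection on `E`. -/
theorem flatConnection_curvature (hDE : IsComplexConnection DE) (hs : TwistedSmoothNear F s x)
    {X Y : Π y : M, TangentSpace (𝓡 n) y}
    (hX : SmoothNear n (EuclideanSpace ℝ (Fin n)) X x)
    (hY : SmoothNear n (EuclideanSpace ℝ (Fin n)) Y x) :
    flatConnection DE (fun y => flatConnection DE s y (Y y)) x (X x)
      - flatConnection DE (fun y => flatConnection DE s y (X y)) x (Y x)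
      - flatConnection DE s x (VectorField.mlieBracket (𝓡 n) X Y x) =
    LinearMap.lTensor (Spinor n) (curvatureEnd hDE (X x) (Y x)) (s x) := by
  refine ext_component fun a => ?_
  rw [component_lTensor]
  simp only [component_sub, component_flatConnection]
  exact curvatureField_eq_curvature hDE.smooth (hs a) hX hY

end FlatConnection

/-! ### Linearity of spin elements in their coefficients. -/

section SpinElement

variable {ι : Type*} [Fintype ι] {A : Type*} [Ring A] [Algebra ℂ A] (c : ι → A)

theorem spinElement_add (v w : ι → ι → ℂ) :
    spinElement c (fun k l => v k l + w k l) = spinElement c v + spinElement c w := by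
  simp only [spinElement, add_smul, Finset.sum_add_distrib, smul_add]

theorem spinElement_sub (v w : ι → ι → ℂ) :
    spinElement c (fun k l => v k l - w k l) = spinElement c v - spinElement c w := by
  simp only [spinElement, sub_smul, Finset.sum_sub_distrib, smul_sub]

theorem spinElement_smul (z : ℂ) (w : ι → ι → ℂ) :
    spinElement c (fun k l => z * w k l) = z • spinElement c w := by
  simp only [spinElement, mul_smul, ← Finset.smul_sum]
  rw [smul_comm]

end SpinElement

/-! ### Twisted spin connection, its curvature and the Lichnerowicz formula. -/

section SpinConnection

variable {n : ℕ} {M : Type*} [TopologicalSpace M] [T2Space M]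
  [ChartedSpace (EuclideanSpace ℝ (Fin n)) M] [IsManifold (𝓡 n) ∞ M]
  [RiemannianBundle (fun x : M => TangentSpace (𝓡 n) x)]
  [IsContMDiffRiemannianBundle (𝓡 n) ∞ (EuclideanSpace ℝ (Fin n))
    (fun x : M => TangentSpace (𝓡 n) x)]
  {F : Type*} [NormedAddCommGroup F] [NormedSpace ℂ F] [FiniteDimensional ℂ F]
  {E : M → Type*} [TopologicalSpace (TotalSpace F E)]
  [∀ x, AddCommGroup (E x)] [∀ x, Module ℂ (E x)] [∀ x, TopologicalSpace (E x)]
  [∀ x, IsTopologicalAddGroup (E x)] [∀ x, ContinuousSMul ℝ (E x)]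
  [FiberBundle F E] [VectorBundle ℂ F E] [VectorBundle ℝ F E]
  [ContMDiffVectorBundle ∞ F E (𝓡 n)]
  {D : AffineConnection n M} {DE : CovariantDerivative (𝓡 n) F E}
  {c : Fin n → Module.End ℂ (Spinor n)}
  {e : Π y : M, OrthonormalBasis (Fin n) ℝ (TangentSpace (𝓡 n) y)}
  {s t : Π y : M, Spinor n ⊗[ℂ] E y} {x : M}

theorem twistedDiffAt_spinElement (hs : TwistedDiffAt F s x) (c : Fin n → Module.End ℂ (Spinor n))
    {w : M → Fin n → Fin n → ℝ} (hw : ∀ k l, FunDiffAt (n := n) (fun y => w y k l) x) :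
    TwistedDiffAt F
      (fun y => spinorAction y (spinElement c fun k l => (w y k l : ℂ)) (s y)) x := by
  have h (y : M) : spinorAction y (spinElement c fun k l => (w y k l : ℂ)) (s y) =
      ∑ k, ∑ l, (w y k l : ℂ) • spinorAction y ((1 / 4 : ℂ) • (c k * c l)) (s y) := by
    simp only [spinElement, map_smul, map_sum, LinearMap.smul_apply, LinearMap.sum_apply,
      Finset.smul_sum, smul_comm (1 / 4 : ℂ)]
  simp only [h]
  exact TwistedDiffAt.sum _ fun k => TwistedDiffAt.sum _ fun l =>
    (hs.spinorAction _).real_smul (hw k l)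

/-- Differentiation of a section multiplied by a variable element of the spin Lie algebra. -/
theorem flatConnection_spinElement (hDE : IsComplexConnection DE) (hs : TwistedDiffAt F s x)
    (c : Fin n → Module.End ℂ (Spinor n))
    {w : M → Fin n → Fin n → ℝ} (hw : ∀ k l, FunDiffAt (n := n) (fun y => w y k l) x)
    (v : TangentSpace (𝓡 n) x) :
    flatConnection DE
        (fun y => spinorAction y (spinElement c fun k l => (w y k l : ℂ)) (s y)) x v =
      spinorAction x (spinElement c fun k l => (w x k l : ℂ)) (flatConnection DE s x v)
      + spinorAction x (spinElement c fun k l => (mvfderiv (𝓡 n) (fun y => w y k l) x v : ℂ))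
        (s x) := by
  -- Separate the variable real coefficients from the constant endomorphisms ¼ c_k c_l, so that the
  -- Leibniz rule applies term by term.
  have h (y : M) (w : Fin n → Fin n → ℝ) (t : Spinor n ⊗[ℂ] E y) :
      spinorAction y (spinElement c fun k l => (w k l : ℂ)) t =
      ∑ k, ∑ l, (w k l : ℂ) • spinorAction y ((1 / 4 : ℂ) • (c k * c l)) t := by
    simp only [spinElement, map_smul, map_sum, LinearMap.smul_apply, LinearMap.sum_apply,
      Finset.smul_sum, smul_comm (1 / 4 : ℂ)]
  have h1 (k l) := (hs.spinorAction ((1 / 4 : ℂ) • (c k * c l)))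
  have h2 (k l) := (h1 k l).real_smul (hw k l)
  have h' (y : M) := h y (w y) (s y)
  simp only [h']
  rw [flatConnection_sum _ fun k => TwistedDiffAt.sum _ fun l => h2 k l]
  simp only [flatConnection_sum _ (h2 _), flatConnection_real_smul (h1 _ _) (hw _ _),
    flatConnection_spinorAction hDE hs, Finset.sum_add_distrib]
  rw [← h x (w x), ← h x (fun k l => mvfderiv (𝓡 n) (fun y => w y k l) x v) (s x)]

/-- The twisted spin connection in the frame `e`, with Clifford multiplication by `e_i` represented
by `c_i`. -/
def spinConnection (D : AffineConnection n M) (DE : CovariantDerivative (𝓡 n) F E)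
    (c : Fin n → Module.End ℂ (Spinor n))
    (e : Π y : M, OrthonormalBasis (Fin n) ℝ (TangentSpace (𝓡 n) y))
    (s : Π y : M, Spinor n ⊗[ℂ] E y) (x : M) (v : TangentSpace (𝓡 n) x) : Spinor n ⊗[ℂ] E x :=
  flatConnection DE s x v
    + spinorAction x (spinElement c fun k l => (connectionForm D e v k l : ℂ)) (s x)

theorem TwistedSmoothNear.diffAt_spinConnection (hD : IsLeviCivita D)
    (hDE : IsComplexConnection DE) (he : SmoothFrameNear e x) (hs : TwistedSmoothNear F s x)
    (c : Fin n → Module.End ℂ (Spinor n)) {Y : Π y : M, TangentSpace (𝓡 n) y}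
    (hY : DiffAt n (EuclideanSpace ℝ (Fin n)) Y x) :
    TwistedDiffAt F (fun y => spinConnection D DE c e s y (Y y)) x :=
  (hs.diffAt_flatConnection hDE hY).add (twistedDiffAt_spinElement hs.diffAt c
    fun k l => diffAt_connectionForm hD he hY k l)

theorem spinConnection_congr (hs : TwistedDiffAt F s x) (ht : TwistedDiffAt F t x)
    (h : ∀ᶠ y in 𝓝 x, s y = t y) (v : TangentSpace (𝓡 n) x) :
    spinConnection D DE c e s x v = spinConnection D DE c e t x v := by
  rw [spinConnection, spinConnection, flatConnection_congr hs ht h, h.self_of_nhds]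

theorem spinConnection_add (hs : TwistedDiffAt F s x) (ht : TwistedDiffAt F t x)
    (v : TangentSpace (𝓡 n) x) :
    spinConnection D DE c e (fun y => s y + t y) x v =
      spinConnection D DE c e s x v + spinConnection D DE c e t x v := by
  rw [spinConnection, spinConnection, spinConnection, flatConnection_add hs ht, map_add]
  abel

theorem spinConnection_sum {ι : Type*} (I : Finset ι) {s : ι → Π y : M, Spinor n ⊗[ℂ] E y}
    (hs : ∀ i, TwistedDiffAt F (s i) x) (v : TangentSpace (𝓡 n) x) :
    spinConnection D DE c e (fun y => ∑ i ∈ I, s i y) x v =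
      ∑ i ∈ I, spinConnection D DE c e (s i) x v := by
  simp only [spinConnection]
  rw [flatConnection_sum I hs, map_sum, Finset.sum_add_distrib]

theorem spinConnection_real_smul (hs : TwistedDiffAt F s x) {g : M → ℝ}
    (hg : FunDiffAt (n := n) g x) (v : TangentSpace (𝓡 n) x) :
    spinConnection D DE c e (fun y => (g y : ℂ) • s y) x v =
      (g x : ℂ) • spinConnection D DE c e s x v + (mvfderiv (𝓡 n) g x v : ℂ) • s x := by
  rw [spinConnection, spinConnection, flatConnection_real_smul hs hg, map_smul]
  module

theorem spinConnection_add_vector (v w : TangentSpace (𝓡 n) x) :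
    spinConnection D DE c e s x (v + w) =
      spinConnection D DE c e s x v + spinConnection D DE c e s x w := by
  simp only [spinConnection, flatConnection_add_vector, connectionForm, map_add, inner_add_left,
    Complex.ofReal_add, spinElement_add, LinearMap.add_apply]
  abel

theorem spinConnection_smul_vector (r : ℝ) (v : TangentSpace (𝓡 n) x) :
    spinConnection D DE c e s x (r • v) = (r : ℂ) • spinConnection D DE c e s x v := by
  simp only [spinConnection, flatConnection_smul_vector, connectionForm, map_smul,
    real_inner_smul_left, Complex.ofReal_mul, spinElement_smul, LinearMap.smul_apply, smul_add]

theorem spinConnection_sub_vector (v w : TangentSpace (𝓡 n) x) :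
    spinConnection D DE c e s x (v - w) =
      spinConnection D DE c e s x v - spinConnection D DE c e s x w := by
  rw [show v - w = v + (-1 : ℝ) • w by module, spinConnection_add_vector,
    spinConnection_smul_vector]
  push_cast
  module

theorem spinConnection_sum_vector {ι : Type*} (I : Finset ι) (r : ι → ℝ)
    (v : ι → TangentSpace (𝓡 n) x) :
    spinConnection D DE c e s x (∑ i ∈ I, r i • v i) =
      ∑ i ∈ I, (r i : ℂ) • spinConnection D DE c e s x (v i) := by
  classical
  induction I using Finset.induction_on with
  | empty =>
    have h := spinConnection_smul_vector (D := D) (DE := DE) (c := c) (e := e) (s := s)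
      0 (0 : TangentSpace (𝓡 n) x)
    rw [zero_smul, Complex.ofReal_zero, zero_smul] at h
    simpa only [Finset.sum_empty] using h
  | insert a I ha ih =>
    rw [Finset.sum_insert ha, Finset.sum_insert ha, spinConnection_add_vector,
      spinConnection_smul_vector, ih]

/-- Clifford multiplication by the vectors of the frame is parallel. -/
theorem spinConnection_clifford (hD : IsLeviCivita D) (hDE : IsComplexConnection DE)
    (hc : CliffordRelations c) (he : SmoothFrameNear e x) (hs : TwistedDiffAt F s x) (m : Fin n)
    (v : TangentSpace (𝓡 n) x) :
    spinConnection D DE c e (fun y => spinorAction y (c m) (s y)) x v =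
      spinorAction x (c m) (spinConnection D DE c e s x v)
      + ∑ j, (connectionForm D e v m j : ℂ) • spinorAction x (c j) (s x) := by
  -- The commutator of the connection matrix with c_m is Σ_j ω(v)_mj c_j, that is, Clifford
  -- multiplication by ∇_v e_m.
  have h := hc.spinElement_commutator (w := fun k l => (connectionForm D e v k l : ℂ))
    (fun k l => by rw [connectionForm_antisymm hD he]; simp) m
  rw [sub_eq_iff_eq_add'] at h
  rw [spinConnection, spinConnection, flatConnection_spinorAction hDE hs, map_add,
    ← Module.End.mul_apply, ← map_mul, h, map_add, map_mul]
  simp only [LinearMap.add_apply, Module.End.mul_apply, map_sum, map_smul, LinearMap.sum_apply,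
    LinearMap.smul_apply]
  abel

/-- The curvature of the twisted spin connection. -/
theorem spinConnection_curvature (hD : IsLeviCivita D) (hDE : IsComplexConnection DE)
    (hc : CliffordRelations c) (he : SmoothFrameNear e x) (hs : TwistedSmoothNear F s x)
    {X Y : Π y : M, TangentSpace (𝓡 n) y}
    (hX : SmoothNear n (EuclideanSpace ℝ (Fin n)) X x)
    (hY : SmoothNear n (EuclideanSpace ℝ (Fin n)) Y x) :
    spinConnection D DE c e (fun y => spinConnection D DE c e s y (Y y)) x (X x)
      - spinConnection D DE c e (fun y => spinConnection D DE c e s y (X y)) x (Y x)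
      - spinConnection D DE c e s x (VectorField.mlieBracket (𝓡 n) X Y x) =
    LinearMap.lTensor (Spinor n) (curvatureEnd hDE (X x) (Y x)) (s x)
      + spinorAction x (spinElement c fun k l =>
        (inner ℝ (curvatureField D X Y (fun y => e y k) x) (e x l) : ℂ)) (s x) := by
  -- The two terms with one connection matrix and one first derivative of s are exchanged by
  -- swapping X and Y, so they cancel in the curvature. The products of connection matrices leave a
  -- commutator.
  have second {X Y : Π y : M, TangentSpace (𝓡 n) y}
      (hY : SmoothNear n (EuclideanSpace ℝ (Fin n)) Y x) :
      spinConnection D DE c e (fun y => spinConnection D DE c e s y (Y y)) x (X x) =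
        flatConnection DE (fun y => flatConnection DE s y (Y y)) x (X x)
        + spinorAction x (spinElement c fun k l => (connectionForm D e (Y x) k l : ℂ))
          (flatConnection DE s x (X x))
        + spinorAction x (spinElement c fun k l =>
          (mvfderiv (𝓡 n) (fun y => connectionForm D e (Y y) k l) x (X x) : ℂ)) (s x)
        + spinorAction x (spinElement c fun k l => (connectionForm D e (X x) k l : ℂ))
          (flatConnection DE s x (Y x))
        + spinorAction x ((spinElement c fun k l => (connectionForm D e (X x) k l : ℂ)) *
          (spinElement c fun k l => (connectionForm D e (Y x) k l : ℂ))) (s x) := by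
    have hw (k l) := diffAt_connectionForm hD he hY.diffAt k l
    rw [spinConnection]
    simp only [spinConnection]
    rw [flatConnection_add (hs.diffAt_flatConnection hDE hY.diffAt)
        (twistedDiffAt_spinElement hs.diffAt c hw),
      flatConnection_spinElement hDE hs.diffAt c hw, map_add, map_mul, Module.End.mul_apply]
    abel
  have hbr := hc.spinElement_bracket (v := fun k l => (connectionForm D e (X x) k l : ℂ))
    (w := fun k l => (connectionForm D e (Y x) k l : ℂ))
    (fun k l => by rw [connectionForm_antisymm hD he]; simp)
    (fun k l => by rw [connectionForm_antisymm hD he]; simp)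
  rw [← flatConnection_curvature hDE hs hX hY, second hY, second hX, spinConnection]
  simp only [inner_curvatureField_eq hD he hX.diffAt hY.diffAt, Complex.ofReal_add,
    Complex.ofReal_sub, Complex.ofReal_sum, Complex.ofReal_mul]
  rw [spinElement_add, spinElement_sub, spinElement_sub, ← hbr]
  simp only [map_add, map_sub, LinearMap.add_apply, LinearMap.sub_apply]
  abel

/-- The Dirac operator in a frame. -/
def frameDirac (D : AffineConnection n M) (DE : CovariantDerivative (𝓡 n) F E)
    (c : Fin n → Module.End ℂ (Spinor n))
    (e : Π y : M, OrthonormalBasis (Fin n) ℝ (TangentSpace (𝓡 n) y))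
    (s : Π y : M, Spinor n ⊗[ℂ] E y) (x : M) : Spinor n ⊗[ℂ] E x :=
  ∑ i, spinorAction x (c i) (spinConnection D DE c e s x (e x i))

/-- The second covariant derivative `∇_i ∇_j - ∇_{∇_i e_j}` in a frame. -/
def secondDerivative (D : AffineConnection n M) (DE : CovariantDerivative (𝓡 n) F E)
    (c : Fin n → Module.End ℂ (Spinor n))
    (e : Π y : M, OrthonormalBasis (Fin n) ℝ (TangentSpace (𝓡 n) y))
    (s : Π y : M, Spinor n ⊗[ℂ] E y) (x : M) (i j : Fin n) : Spinor n ⊗[ℂ] E x :=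
  spinConnection D DE c e (fun y => spinConnection D DE c e s y (e y j)) x (e x i)
    - spinConnection D DE c e s x (D (fun y => e y j) x (e x i))

/-- Parallelism of Clifford multiplication gives ∇_i(c_j ∇_j s) = c_j ∇_i∇_j s + Σ_k ω_jk(e_i) c_k
∇_j s. Exchanging j and k, antisymmetry of ω turns the sum over j of the last terms into -Σ_j c_j
∇_{∇_i e_j} s, the correction in the second covariant derivative. -/
theorem frameDirac_frameDirac (hD : IsLeviCivita D) (hDE : IsComplexConnection DE)
    (hc : CliffordRelations c) (he : SmoothFrameNear e x) (hs : TwistedSmoothNear F s x) :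
    frameDirac D DE c e (frameDirac D DE c e s) x =
      ∑ i, ∑ j, spinorAction x (c i * c j) (secondDerivative D DE c e s x i j) := by
  have hd (j) := hs.diffAt_spinConnection hD hDE he c (he j).diffAt
  have h (i : Fin n) : spinConnection D DE c e (frameDirac D DE c e s) x (e x i) =
      ∑ j, spinorAction x (c j) (secondDerivative D DE c e s x i j) := by
    change spinConnection D DE c e (fun y => ∑ j, spinorAction y (c j)
      (spinConnection D DE c e s y (e y j))) x (e x i) = _
    rw [spinConnection_sum _ fun j => (hd j).spinorAction (c j)]
    simp only [spinConnection_clifford hD hDE hc he (hd _), secondDerivative, map_sub,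
      Finset.sum_add_distrib, Finset.sum_sub_distrib]
    rw [sub_eq_add_neg]
    congr 1
    rw [Finset.sum_comm, ← Finset.sum_neg_distrib]
    refine Finset.sum_congr rfl fun k _ => ?_
    rw [covariantDerivative_eq_sum, spinConnection_sum_vector, map_sum, ← Finset.sum_neg_distrib]
    refine Finset.sum_congr rfl fun j _ => ?_
    rw [connectionForm_antisymm hD he, Complex.ofReal_neg, map_smul]
    module
  rw [frameDirac]
  simp only [h, map_sum, map_mul, Module.End.mul_apply]

/-- The Lichnerowicz formula for the twisted Dirac operator. -/
theorem lichnerowicz (hD : IsLeviCivita D) (hDE : IsComplexConnection DE)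
    (hc : CliffordRelations c) (he : SmoothFrameNear e x) (hs : TwistedSmoothNear F s x) :
    frameDirac D DE c e (frameDirac D DE c e s) x =
      -∑ i, secondDerivative D DE c e s x i i
        + ((1 / 4 * scalarCurvature D x : ℝ) : ℂ) • s x
        + (1 / 2 : ℂ) • ∑ i, ∑ j, spinorAction x (c i * c j)
          (LinearMap.lTensor (Spinor n) (curvatureEnd hDE (e x i) (e x j)) (s x)) := by
  set T := secondDerivative D DE c e s x
  set K : Fin n → Fin n → Spinor n ⊗[ℂ] E x := fun i j =>
    LinearMap.lTensor (Spinor n) (curvatureEnd hDE (e x i) (e x j)) (s x)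
  -- Vanishing torsion identifies ∇_i e_j - ∇_j e_i with [e_i, e_j], so the antisymmetrised second
  -- derivative is the curvature.
  have hT (i j : Fin n) : T i j - T j i = K i j + spinorAction x (spinElement c fun k l =>
      (curvatureComponent D e x i j k l : ℂ)) (s x) := by
    have h := spinConnection_curvature hD hDE hc he hs (he i) (he j)
    rw [← hD.sub_eq_mlieBracket (he i).diffAt (he j).diffAt, spinConnection_sub_vector] at h
    simp only [K, curvatureComponent]
    rw [← h]
    simp only [T, secondDerivative]
    abel
  -- Symmetric and antisymmetric parts of the second derivative, doubled to avoid halves; only the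
  -- diagonal of the symmetric part survives the Clifford relations.
  have hsym : (2 : ℂ) • ∑ i, ∑ j, spinorAction x (c i * c j) (T i j) =
      ∑ i, ∑ j, spinorAction x (c i * c j) (T i j - T j i) + (2 : ℂ) • -∑ i, T i i := by
    have h1 : ∑ i, ∑ j, spinorAction x (c i * c j) (T j i) =
        (2 : ℂ) • -∑ i, T i i - ∑ i, ∑ j, spinorAction x (c i * c j) (T i j) := by
      have h2 : ∑ i, ∑ j, spinorAction x (c i * c j) (T i j) =
          ∑ i, ∑ j, spinorAction x (c j * c i) (T j i) := Finset.sum_comm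
      rw [eq_sub_iff_add_eq, h2]
      have h3 (i j : Fin n) : spinorAction x (c i * c j) (T j i) + spinorAction x (c j * c i) (T j i)
          = if i = j then (-2 : ℂ) • T i i else 0 := by
        rw [← LinearMap.add_apply, ← map_add, hc i j, map_smul, map_one, LinearMap.smul_apply,
          Module.End.one_apply]
        split_ifs with h
        · rw [h]
        · rw [zero_smul]
      simp only [← Finset.sum_add_distrib, h3, Finset.sum_ite_eq, Finset.mem_univ, if_true,
        ← Finset.smul_sum]
      module
    simp only [map_sub, Finset.sum_sub_distrib, h1]
    module
  -- Here ½ is the ¼ in `spinElement` times the 2 in `curvature_contraction`; undoing the doubling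
  -- makes it the ¼ of the formula.
  have hcontr : ∑ i, ∑ j, spinorAction x (c i * c j) (spinorAction x (spinElement c fun k l =>
      (curvatureComponent D e x i j k l : ℂ)) (s x)) =
      (1 / 2 : ℂ) • (scalarCurvature D x : ℂ) • s x := by
    have h := hc.curvature_contraction
      (R := fun i j k l => (curvatureComponent D e x i j k l : ℂ))
      (fun i j k l => by rw [curvatureComponent_antisymm_left]; simp)
      (fun i j k l => by rw [curvatureComponent_antisymm_right hD he]; simp)
      (fun i j k l => by exact_mod_cast curvatureComponent_bianchi hD he i j k l)
    have h1 : ∑ i, ∑ j, (c i * c j) * (spinElement c fun k l =>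
        (curvatureComponent D e x i j k l : ℂ)) =
        ((1 / 2 : ℂ) * (scalarCurvature D x : ℂ)) • 1 := by
      simp only [spinElement, mul_smul_comm, Finset.mul_sum, ← Finset.smul_sum]
      rw [h, scalarCurvature_eq_sum_component hD he]
      push_cast
      module
    have h2 := congrArg (fun B => spinorAction x B (s x)) h1
    simpa only [map_sum, map_mul, LinearMap.sum_apply, Module.End.mul_apply, map_smul, map_one,
      LinearMap.smul_apply, Module.End.one_apply, mul_smul] using h2
  rw [frameDirac_frameDirac hD hDE hc he hs]
  refine smul_right_injective _ (two_ne_zero' ℂ) ?_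
  change (2 : ℂ) • _ = (2 : ℂ) • _
  rw [hsym]
  simp only [hT, map_add, Finset.sum_add_distrib]
  rw [hcontr]
  push_cast
  module

/-- The connection Laplacian of the product of a function and a section. -/
theorem sum_secondDerivative_real_smul (hD : IsLeviCivita D) (hDE : IsComplexConnection DE)
    (he : SmoothFrameNear e x) (hs : TwistedSmoothNear F s x) {g : M → ℝ}
    (hg : FunSmoothNear (n := n) g x) :
    ∑ i, secondDerivative D DE c e (fun y => (g y : ℂ) • s y) x i i =
      (g x : ℂ) • ∑ i, secondDerivative D DE c e s x i i
        + (2 : ℂ) • spinConnection D DE c e s x (gradient g x)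
        + (laplacian D g x : ℂ) • s x := by
  have h (i : Fin n) : secondDerivative D DE c e (fun y => (g y : ℂ) • s y) x i i =
      (g x : ℂ) • secondDerivative D DE c e s x i i
        + (2 : ℂ) • (mvfderiv (𝓡 n) g x (e x i) : ℂ) • spinConnection D DE c e s x (e x i)
        + ((mvfderiv (𝓡 n) (fun y => mvfderiv (𝓡 n) g y (e y i)) x (e x i)
          - mvfderiv (𝓡 n) g x (D (fun y => e y i) x (e x i)) : ℝ) : ℂ) • s x := by
    have hi := hs.diffAt_spinConnection hD hDE he c (he i).diffAt
    have hgi := hg.mvfderiv (he i)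
    -- The first Leibniz rule is needed on a neighbourhood, since it is differentiated once more at
    -- x.
    have h1 : ∀ᶠ y in 𝓝 x, spinConnection D DE c e (fun y => (g y : ℂ) • s y) y (e y i) =
        (g y : ℂ) • spinConnection D DE c e s y (e y i)
          + (mvfderiv (𝓡 n) g y (e y i) : ℂ) • s y := by
      filter_upwards [hs.eventually, hg.eventually] with y h1 h2
      exact spinConnection_real_smul h1.diffAt h2.diffAt _
    have h2 := hi.real_smul hg.diffAt
    have h3 := hs.diffAt.real_smul hgi.diffAt
    rw [secondDerivative, spinConnection_congr ((h2.add h3).congr h1) (h2.add h3) h1,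
      spinConnection_add h2 h3, spinConnection_real_smul hi hg.diffAt,
      spinConnection_real_smul hs.diffAt hgi.diffAt, spinConnection_real_smul hs.diffAt hg.diffAt,
      secondDerivative]
    push_cast
    module
  simp only [h, Finset.sum_add_distrib, ← Finset.smul_sum, ← Finset.sum_smul]
  rw [gradient_eq_sum g (e x), spinConnection_sum_vector, laplacian_eq_sum hD he hg]
  push_cast
  rfl

end SpinConnection

/-! ### Gradient and Laplacian of e^{-f/2}. -/

section ExponentialWeight

variable {n : ℕ} {M : Type*} [TopologicalSpace M]
  [ChartedSpace (EuclideanSpace ℝ (Fin n)) M] [IsManifold (𝓡 n) ∞ M] {f : M → ℝ} {x : M}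

theorem FunSmoothNear.exp_neg_half (hf : FunSmoothNear (n := n) f x) :
    FunSmoothNear (n := n) (fun y => Real.exp (-f y / 2)) x := by
  obtain ⟨U, hU, hf⟩ := hf
  have h : ContDiff ℝ ∞ (fun t : ℝ => Real.exp (-t / 2)) := by fun_prop
  exact ⟨U, hU, h.contMDiff.comp_contMDiffOn hf⟩

theorem mvfderiv_exp_neg_half (hf : FunDiffAt (n := n) f x) (v : TangentSpace (𝓡 n) x) :
    mvfderiv (𝓡 n) (fun y => Real.exp (-f y / 2)) x v =
      -(1 / 2) * (Real.exp (-f x / 2) * mvfderiv (𝓡 n) f x v) := by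
  have h1 : HasDerivAt (fun t : ℝ => Real.exp (-t / 2)) (Real.exp (-f x / 2) * (-1 / 2)) (f x) :=
    (((hasDerivAt_id (f x)).neg).div_const 2).exp
  have h2 := h1.hasFDerivAt.hasMFDerivAt.comp x (MDifferentiableAt.hasMFDerivAt hf)
  have h3 : mvfderiv (𝓡 n) (fun y => Real.exp (-f y / 2)) x v =
      mvfderiv (𝓡 n) f x v * (Real.exp (-f x / 2) * (-1 / 2)) :=
    congrArg (fun L => L v) h2.mfderiv
  rw [h3]
  ring

variable [T2Space M] [RiemannianBundle (fun x : M => TangentSpace (𝓡 n) x)]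
  [IsContMDiffRiemannianBundle (𝓡 n) ∞ (EuclideanSpace ℝ (Fin n))
    (fun x : M => TangentSpace (𝓡 n) x)]

theorem gradient_exp_neg_half (hf : FunDiffAt (n := n) f x) :
    (gradient (fun y => Real.exp (-f y / 2)) x : TangentSpace (𝓡 n) x) =
      (-(1 / 2) * Real.exp (-f x / 2)) • gradient f x := by
  simp only [gradient, mvfderiv_exp_neg_half hf, Finset.smul_sum, smul_smul, mul_assoc]

/-- In the frame, differentiating the exponential factor twice produces ¼ Σ (e_i f)², which is the
gradient term by Parseval; the remaining terms reproduce the Laplacian of f with factor -½. -/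
theorem laplacian_exp_neg_half {D : AffineConnection n M} (hD : IsLeviCivita D)
    {e : Π y : M, OrthonormalBasis (Fin n) ℝ (TangentSpace (𝓡 n) y)} (he : SmoothFrameNear e x)
    (hf : FunSmoothNear (n := n) f x) :
    laplacian D (fun y => Real.exp (-f y / 2)) x =
      Real.exp (-f x / 2) *
        (-(1 / 2) * laplacian D f x + 1 / 4 * ‖(gradient f x : TangentSpace (𝓡 n) x)‖ ^ 2) := by
  have h (i : Fin n) :
      mvfderiv (𝓡 n) (fun y => mvfderiv (𝓡 n) (fun y => Real.exp (-f y / 2)) y (e y i)) x (e x i) =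
        Real.exp (-f x / 2) *
          (-(1 / 2) * mvfderiv (𝓡 n) (fun y => mvfderiv (𝓡 n) f y (e y i)) x (e x i)
            + 1 / 4 * mvfderiv (𝓡 n) f x (e x i) ^ 2) := by
    have h1 : ∀ᶠ y in 𝓝 x, mvfderiv (𝓡 n) (fun y => Real.exp (-f y / 2)) y (e y i) =
        ((fun _ => -(1 / 2)) * ((fun y => Real.exp (-f y / 2)) * fun y => mvfderiv (𝓡 n) f y (e y i))
          : M → ℝ) y := by
      filter_upwards [hf.eventually] with y hy
      exact mvfderiv_exp_neg_half hy.diffAt _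
    have h2 := hf.exp_neg_half.diffAt
    have h3 := (hf.mvfderiv (he i)).diffAt
    rw [mvfderiv_congr_of_eventuallyEq h1, mvfderiv_mul mdifferentiableAt_const
      (MDifferentiableAt.mul h2 h3), mvfderiv_mul h2 h3, mvfderiv_const]
    simp only [add_apply, smul_apply, smul_eq_mul, zero_apply, mvfderiv_exp_neg_half hf.diffAt]
    ring
  rw [laplacian_eq_sum hD he hf, laplacian_eq_sum hD he hf.exp_neg_half, norm_gradient_sq f (e x)]
  simp only [h, mvfderiv_exp_neg_half hf.diffAt, Finset.mul_sum, ← Finset.sum_add_distrib]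
  refine Finset.sum_congr rfl fun i _ => ?_
  ring

end ExponentialWeight

/-! ### Passage from spin gauges to frames with constant Clifford matrices. -/

section Gauge

theorem vec_single_relations {n : ℕ} (i j : Fin n) :
    vec (Pi.single i 1) * vec (Pi.single j 1) + vec (Pi.single j 1) * vec (Pi.single i 1) =
      algebraMap ℝ (Cl n) (if i = j then -2 else 0) := by
  rw [vec, CliffordAlgebra.ι_mul_ι_add_swap]
  congr 1
  simp only [QuadraticMap.polar, cliffordForm, QuadraticMap.weightedSumSquares_apply, Pi.add_apply,
    ← Finset.sum_sub_distrib, smul_eq_mul]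
  have h (k : Fin n) : -1 * (((Pi.single i 1 : Fin n → ℝ) k + (Pi.single j 1 : Fin n → ℝ) k) *
      ((Pi.single i 1 : Fin n → ℝ) k + (Pi.single j 1 : Fin n → ℝ) k))
      - -1 * ((Pi.single i 1 : Fin n → ℝ) k * (Pi.single i 1 : Fin n → ℝ) k)
      - -1 * ((Pi.single j 1 : Fin n → ℝ) k * (Pi.single j 1 : Fin n → ℝ) k) =
      if k = i then (if i = j then -2 else 0) else 0 := by
    rcases eq_or_ne k i with rfl | hk
    · rcases eq_or_ne k j with rfl | hj
      · norm_num
      · simp [hj]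
    · simp [hk]
  simp only [h, Finset.sum_ite_eq', Finset.mem_univ, if_true]

theorem cliffordRelations_spinorRep {n : ℕ} (ρ : SpinorRep n) :
    CliffordRelations (fun i : Fin n => ρ (vec (Pi.single i 1))) := by
  intro i j
  have h := congrArg ρ (vec_single_relations i j)
  rw [map_add, map_mul, map_mul, AlgHom.commutes] at h
  refine h.trans ?_
  ext ψ a
  split_ifs <;> simp [Algebra.algebraMap_eq_smul_one]

variable {n : ℕ} {M : Type*} [TopologicalSpace M] [T2Space M]
  [ChartedSpace (EuclideanSpace ℝ (Fin n)) M] [IsManifold (𝓡 n) ∞ M]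
  [RiemannianBundle (fun x : M => TangentSpace (𝓡 n) x)]
  [IsContMDiffRiemannianBundle (𝓡 n) ∞ (EuclideanSpace ℝ (Fin n))
    (fun x : M => TangentSpace (𝓡 n) x)]
  {D : AffineConnection n M} {o : ManifoldOrientation n M} {σ : SpinStructure o} {ρ : SpinorRep n}
  {F : Type*} [NormedAddCommGroup F] [NormedSpace ℂ F] [FiniteDimensional ℂ F]
  {E : M → Type*} [TopologicalSpace (TotalSpace F E)]
  [∀ x, AddCommGroup (E x)] [∀ x, Module ℂ (E x)] [∀ x, TopologicalSpace (E x)]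
  [∀ x, IsTopologicalAddGroup (E x)] [∀ x, ContinuousSMul ℝ (E x)]
  [FiberBundle F E] [VectorBundle ℂ F E] [VectorBundle ℝ F E]
  [ContMDiffVectorBundle ∞ F E (𝓡 n)]
  {DE : CovariantDerivative (𝓡 n) F E}

/-- The orthonormal bases below a spin gauge. -/
def SpinGauge.orthonormalFrame (G : SpinGauge σ) (y : M) :
    OrthonormalBasis (Fin n) ℝ (TangentSpace (𝓡 n) y) :=
  σ.frame (G.lift y)

theorem SpinGauge.smoothFrameNear (G : SpinGauge σ) {x : M} (hx : x ∈ G.domain) :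
    SmoothFrameNear G.orthonormalFrame x :=
  fun i => ⟨G.domain, G.isOpen_domain.mem_nhds hx, G.contMDiffOn_frame i⟩

/-- In its own orthonormal frame e_i has the i-th standard coordinate vector, so its Clifford matrix
depends neither on the point nor on the gauge. This is what allows the constant family c in the
frame computations. -/
theorem clifford_frame (G : SpinGauge σ) (i : Fin n) (x : M) :
    clifford ρ G (G.frame i x) = ρ (vec (Pi.single i 1)) := by
  rw [clifford]
  congr 2
  ext j
  rw [SpinGauge.frame, SpinGauge.frame, (σ.frame (G.lift x)).inner_eq_ite, Pi.single_apply]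

theorem twistedConnection_eq (φ : GaugeField σ E) (G : SpinGauge σ) (x : M)
    (v : TangentSpace (𝓡 n) x) :
    twistedConnection ρ D DE φ G x v =
      spinConnection D DE (fun i => ρ (vec (Pi.single i 1))) G.orthonormalFrame (φ G) x v := by
  simp only [twistedConnection, spinConnectionForm, clifford_frame]
  rfl

theorem twistedDirac_eq (φ : GaugeField σ E) (G : SpinGauge σ) :
    twistedDirac ρ D DE φ G =
      frameDirac D DE (fun i => ρ (vec (Pi.single i 1))) G.orthonormalFrame (φ G) := by
  ext x
  simp only [twistedDirac, clifford_frame, twistedConnection_eq]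
  rfl

theorem connectionLaplacian_eq (φ : GaugeField σ E) (G : SpinGauge σ) (x : M) :
    connectionLaplacian ρ D DE φ G x = ∑ i, secondDerivative D DE
      (fun i => ρ (vec (Pi.single i 1))) G.orthonormalFrame (φ G) x i i := by
  simp only [connectionLaplacian, twistedConnection_eq]
  rfl

theorem twistingCurvature_eq (hDE : IsComplexConnection DE) (φ : GaugeField σ E)
    (G : SpinGauge σ) (x : M) :
    twistingCurvature ρ hDE φ G x = (1 / 2 : ℂ) • ∑ i, ∑ j,
      spinorAction x (ρ (vec (Pi.single i 1)) * ρ (vec (Pi.single j 1)))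
        (LinearMap.lTensor (Spinor n) (curvatureEnd hDE (G.orthonormalFrame x i)
          (G.orthonormalFrame x j)) (φ G x)) := by
  simp only [twistingCurvature, clifford_frame, ← LinearMap.rTensor_comp_lTensor]
  rfl

/-- Between the two Dirac operators e^{-f/2} meets e^{f/2} and disappears; only the outer factors
remain. -/
theorem weightedTwistedDirac_sq_eq (f : M → ℝ) (φ : GaugeField σ E) (G : SpinGauge σ) (x : M) :
    weightedTwistedDirac ρ D DE f (weightedTwistedDirac ρ D DE f φ) G x =
      (Real.exp (f x / 2) : ℂ) • frameDirac D DE (fun i => ρ (vec (Pi.single i 1)))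
        G.orthonormalFrame (frameDirac D DE (fun i => ρ (vec (Pi.single i 1)))
          G.orthonormalFrame (fun y => (Real.exp (-f y / 2) : ℂ) • φ G y)) x := by
  have h : mulFun (fun x => Real.exp (-f x / 2)) (weightedTwistedDirac ρ D DE f φ) G =
      twistedDirac ρ D DE (mulFun (fun x => Real.exp (-f x / 2)) φ) G := by
    ext y
    simp only [weightedTwistedDirac, mulFun, smul_smul]
    rw [← Complex.ofReal_mul, ← Real.exp_add, show -f y / 2 + f y / 2 = 0 by ring, Real.exp_zero,
      Complex.ofReal_one, one_smul]
  rw [weightedTwistedDirac, mulFun, twistedDirac_eq, h, twistedDirac_eq]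
  rfl

end Gauge

end

end WeightedSpin

/-! ### The weighted Lichnerowicz formula. -/

theorem mainTheorem7 {n : ℕ} {M : Type*} [TopologicalSpace M] [T2Space M]
    [ChartedSpace (EuclideanSpace ℝ (Fin n)) M] [IsManifold (𝓡 n) ∞ M]
    [RiemannianBundle (fun x : M => TangentSpace (𝓡 n) x)]
    [IsContMDiffRiemannianBundle (𝓡 n) ∞ (EuclideanSpace ℝ (Fin n))
      (fun x : M => TangentSpace (𝓡 n) x)]
    (D : WeightedSpin.AffineConnection n M) (hD : WeightedSpin.IsLeviCivita D)
    (o : WeightedSpin.ManifoldOrientation n M) (σ : WeightedSpin.SpinStructure o)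
    (ρ : WeightedSpin.SpinorRep n)
    {F : Type*} [NormedAddCommGroup F] [NormedSpace ℂ F] [FiniteDimensional ℂ F]
    {E : M → Type*} [TopologicalSpace (TotalSpace F E)]
    [∀ x, AddCommGroup (E x)] [∀ x, Module ℂ (E x)] [∀ x, TopologicalSpace (E x)]
    [∀ x, IsTopologicalAddGroup (E x)] [∀ x, ContinuousSMul ℝ (E x)]
    [FiberBundle F E] [VectorBundle ℂ F E] [VectorBundle ℝ F E]
    [ContMDiffVectorBundle ∞ F E (𝓡 n)]
    (DE : CovariantDerivative (𝓡 n) F E) (hDE : WeightedSpin.IsComplexConnection DE)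
    (f : M → ℝ) (hf : ContMDiff (𝓡 n) 𝓘(ℝ, ℝ) ∞ f)
    (Ψ : WeightedSpin.TwistedSpinor σ ρ E) (hΨ : Ψ.IsSmooth F)
    (G : WeightedSpin.SpinGauge σ) (x : M) (hx : x ∈ G.domain) :
    WeightedSpin.weightedTwistedDirac ρ D DE f
        (WeightedSpin.weightedTwistedDirac ρ D DE f Ψ.rep) G x =
      -WeightedSpin.weightedConnectionLaplacian ρ D DE f Ψ.rep G x
        + ((1 / 4 * WeightedSpin.weightedScalarCurvature D f x : ℝ) : ℂ) • Ψ.rep G x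
        + WeightedSpin.twistingCurvature ρ hDE Ψ.rep G x := by
  have he := G.smoothFrameNear hx
  have hs : WeightedSpin.TwistedSmoothNear F (Ψ.rep G) x :=
    fun a => ⟨G.domain, G.isOpen_domain.mem_nhds hx, hΨ G a⟩
  have hf' : WeightedSpin.FunSmoothNear (n := n) f x :=
    ⟨Set.univ, Filter.univ_mem, hf.contMDiffOn⟩
  have hexp : (Real.exp (f x / 2) : ℂ) * (Real.exp (-f x / 2) : ℂ) = 1 := by
    rw [← Complex.ofReal_mul, ← Real.exp_add, show f x / 2 + -f x / 2 = 0 by ring, Real.exp_zero,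
      Complex.ofReal_one]
  -- Lichnerowicz is applied to the section e^{-f/2}Ψ; the Leibniz rule for the Laplacian then
  -- brings out the derivatives of the weight.
  rw [WeightedSpin.weightedTwistedDirac_sq_eq, WeightedSpin.lichnerowicz hD hDE
      (WeightedSpin.cliffordRelations_spinorRep ρ) he (hs.real_smul hf'.exp_neg_half),
    WeightedSpin.sum_secondDerivative_real_smul hD hDE he hs hf'.exp_neg_half,
    WeightedSpin.gradient_exp_neg_half hf'.diffAt, WeightedSpin.laplacian_exp_neg_half hD he hf',
    WeightedSpin.spinConnection_smul_vector, WeightedSpin.weightedConnectionLaplacian,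
    WeightedSpin.connectionLaplacian_eq, WeightedSpin.twistedConnection_eq,
    WeightedSpin.twistingCurvature_eq, WeightedSpin.weightedScalarCurvature]
  simp only [map_smul, ← Finset.smul_sum]
  push_cast at hexp ⊢
  -- Once all derivatives are evaluated, only the fact that the two exponentials are mutually
  -- inverse matters, and comparing coefficients is field arithmetic.
  generalize Complex.exp ((f x : ℂ) / 2) = p at hexp ⊢
  generalize Complex.exp (-(f x : ℂ) / 2) = q at hexp ⊢
  obtain rfl : q = p⁻¹ := eq_inv_of_mul_eq_one_right hexp
  have hp : p ≠ 0 := left_ne_zero_of_mul_eq_one hexp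
  match_scalars <;> field_simp
  ring
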